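/- **Superspaces.** $E^{6|8}$ has body $\mathbb R^6$ with complex coordinate functions $y^{ab}=-y^{ba}$ ($1\le a,b\le 4$), namely $y^{13}=x_0+ix_1$, $y^{24}=x_0-ix_1$, $y^{14}=x_2+ix_3$, $y^{23}=-x_2+ix_3$, $y^{12}=x_4+ix_5$, $y^{34}=-x_4+ix_5$, and odd coordinates $\theta^{ai}$ ($a=1,\dots,4$, $i=1,2$). $E^{4|8}$ has body $\mathbb R^4=\{y^{12}=y^{34}=0\}$ with $y^{1\dot1}=y^{13}$, $y^{1\dot2}=y^{14}$, $y^{2\dot1}=y^{23}$, $y^{2\dot2}=y^{24}$, and odd coordinates $\theta^{a(i)},\bar\theta^{\dot a(i)}$ ($a,\dot a,i\in\{1,2\}$). Superfunctions are smooth maps from (open sets of) the body to the complex Grassmann algebra on the odd coordinates and on $N\ge 0$ further odd parameters, which are treated as constants ($N$ is arbitrary; $N=0$ is the case without parameters). With $\epsilon_{12}=1=-\epsilon_{21}$, $\epsilon_{11}=\epsilon_{22}=0$, $\partial_{ab}=\partial/\partial y^{ab}$ for $a<b$, $\partial_{ba}=-\partial_{ab}$, and $\partial_{a\dot b}=\partial/\partial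 y^{a\dot b}$, put $$D_{ai}=\partial_{\theta^{ai}}-\sum_{b,j}\epsilon_{ij}\theta^{bj}\partial_{ab}\quad\text{on }E^{6|8},$$ $$D_a^{(i)}=\partial_{\theta^{a(i)}}-\sum_b\bar\theta^{\dot b(i)}\partial_{a\dot b},\qquad \bar D_{\dot a}^{(i)}=\partial_{\bar\theta^{\dot a(i)}}-\sum_b\theta^{b(i)}\partial_{b\dot a}\quad\text{on }E^{4|8}.$$ The odd distributions are those spanned by the $D_{ai}$, respectively by the $D_a^{(i)},\bar D^{(i)}_{\dot a}$. **Connections.** Let $\mathcal P$ be a principal $SU(2)$-bundle over $E^{4|8}$ (transition functions may depend on the odd parameters), and let $\mathcal P_6$ be its pull-back along the projection $E^{6|8}\to E^{4|8}$ that forgets $y^{12},y^{34}$ and identifies the odd coordinates by $\theta^{1i}=\theta^{1(i)}$, $\theta^{2i}=\theta^{2(i)}$, $\theta^{31}=-\bar\theta^{\dot1(2)}$, $\theta^{32}=\bar\theta^{\dot1(1)}$, $\theta^{41}=-\bar\theta^{\dot2(2)}$, $\theta^{42}=\bar\theta^{\dot2(1)}$. A superconnection is given locally by an even one-form $A$ with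 values in $su(2)$, $\nabla_X=X+A(X)$, with curvature $F(X,Y)=[\nabla_X,\nabla_Y]-\nabla_{[X,Y]}$ (super brackets). A connection on $\mathcal P_6$ is *constrained* if $F(X,Y)=0$ for all odd sections $X,Y$ of the odd distribution, and *translation-invariant* if it is invariant under all translations in the two even directions of $y^{12},y^{34}$. A connection on $\mathcal P$ is *semi-constrained* if there are even sections $\Sigma,\bar\Sigma$ of the adjoint bundle of $\mathcal P$ such that along the odd distribution $F(D_a^{(i)},\bar D_{\dot b}^{(j)})=0$ and $$F(D_a^{(i)},D_b^{(j)})=-\epsilon_{ab}\epsilon_{ij}\bar\Sigma,\qquad F(\bar D_{\dot a}^{(i)},\bar D_{\dot b}^{(j)})=-\epsilon_{ab}\epsilon_{ij}\Sigma ,$$ that is, the odd-odd curvature vanishes on pairs of these fields except $[\nabla_{D_1^{(2)}},\nabla_{D_2^{(1)}}]=-[\nabla_{D_2^{(2)}},\nabla_{D_1^{(1)}}]=\bar\Sigma$ and $[\nabla_{\bar D_{\dot1}^{(2)}},\nabla_{\bar D_{\dot2}^{(1)}}]=-[\nabla_{\bar D_{\dot2}^{(2)}},\nabla_{\bar D_{\dot1}^{(1)}}]=\Sigma$.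 **Theorem.** For every $N$ and every such $\mathcal P$, dimensional reduction is a bijection from the set of constrained, translation-invariant connections $A$ on $\mathcal P_6$ onto the set of semi-constrained connections $B$ on $\mathcal P$. Here the reduction $B$ of $A$ is determined by restricting to $y^{12}=y^{34}=0$ and setting $$B(D_1^{(i)})=A(D_{1i}),\quad B(D_2^{(i)})=A(D_{2i}),$$ $$B(\bar D_{\dot1}^{(2)})=-A(D_{31}),\quad B(\bar D_{\dot1}^{(1)})=A(D_{32}),\quad B(\bar D_{\dot2}^{(2)})=-A(D_{41}),\quad B(\bar D_{\dot2}^{(1)})=A(D_{42}),$$ $$B(\partial_{1\dot1})=A(\partial_{13}),\quad B(\partial_{1\dot2})=A(\partial_{14}),\quad B(\partial_{2\dot1})=A(\partial_{23}),\quad B(\partial_{2\dot2})=A(\partial_{24}).$$ Moreover, the scalars of $B$ are the restrictions $\Sigma=2A(\partial_{34})$ and $\bar\Sigma=2A(\partial_{12})$, i.e. twice the difference between the covariant derivative along $\partial_{34}$, respectively $\partial_{12}$, and its trivial lift. -/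

import Mathlib

open scoped ContDiff

noncomputable section

namespace SuperConn

/-! ### Superdomains

Superfunctions on the superdomain with even coordinates `x_k` (`k : Fin n`, real) and odd
coordinates `θ^j` (`j : J`), with `N` auxiliary odd parameters `η^1, …, η^N`, are the smooth maps
from (open subsets of) `ℝⁿ` to the complex Grassmann algebra on the `θ^j` and `η^s`.
The parameters are constants: no vector field differentiates them, and for `N = 0` they are absent.
-/

/-- The complex Grassmann algebra on generators indexed by `J`. -/
abbrev Gr (J : Type) : Type := ExteriorAlgebra ℂ (J → ℂ)

instance grFinite (J : Type) [Fintype J] : Module.Finite ℂ (Gr J) :=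
  Module.Finite.of_basis
    ((Pi.basisFun ℂ J).reindex (Fintype.equivFin J)).ExteriorAlgebra

/-- A norm on the finite-dimensional space `Gr J`, used only to speak of smoothness and of partial
derivatives, which do not depend on its choice. -/
instance grNormedAddCommGroup (J : Type) [Fintype J] : NormedAddCommGroup (Gr J) :=
  NormedAddCommGroup.induced (Gr J) (Fin (Module.finrank ℂ (Gr J)) → ℂ)
    (Module.finBasis ℂ (Gr J)).equivFun (Module.finBasis ℂ (Gr J)).equivFun.injective

instance grNormedSpace (J : Type) [Fintype J] : NormedSpace ℂ (Gr J) :=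
  NormedSpace.induced ℂ (Gr J) (Fin (Module.finrank ℂ (Gr J)) → ℂ)
    (Module.finBasis ℂ (Gr J)).equivFun.toLinearMap

/-- The elements of parity `p` of the Grassmann algebra. -/
abbrev parityPart (J : Type) (p : ZMod 2) : Submodule ℂ (Gr J) :=
  CliffordAlgebra.evenOdd (0 : QuadraticForm ℂ (J → ℂ)) p

/-- The generator with index `j`. -/
def gen {J : Type} [DecidableEq J] (j : J) : Gr J :=
  ExteriorAlgebra.ι ℂ (Pi.single j 1)

/-- The body of an element: all generators are set to zero. -/
abbrev body (J : Type) : Gr J →ₐ[ℂ] ℂ := ExteriorAlgebra.algebraMapInv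

/-- Superfunctions: even coordinates `Fin n`, odd coordinates `J`, odd parameters `Fin N`. -/
abbrev SFun (n : ℕ) (J : Type) (N : ℕ) : Type := (Fin n → ℝ) → Gr (J ⊕ Fin N)

/-- Superfunctions with values in the `2 × 2` matrices. -/
abbrev MFun (n : ℕ) (J : Type) (N : ℕ) : Type :=
  (Fin n → ℝ) → Matrix (Fin 2) (Fin 2) (Gr (J ⊕ Fin N))

/-- The coordinate derivatives `∂/∂x_k` and (left derivative) `∂/∂θ^j`. -/
def pder {n : ℕ} {J : Type} [Fintype J] {N : ℕ} : Fin n ⊕ J → SFun n J N → SFun n J N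
  | Sum.inl k, f => fun x => fderiv ℝ f x (Pi.single k 1)
  | Sum.inr j, f => fun x => CliffordAlgebra.contractLeft (LinearMap.proj (Sum.inl j)) (f x)

/-- The vector field `∑ X^k ∂_k`, given by its coefficients. -/
abbrev VField (n : ℕ) (J : Type) (N : ℕ) : Type := Fin n ⊕ J → SFun n J N

/-- The derivative of a superfunction along a vector field. -/
def VField.act {n : ℕ} {J : Type} [Fintype J] {N : ℕ} (X : VField n J N) (f : SFun n J N) :
    SFun n J N :=
  fun x => ∑ k, X k x * pder k f x

/-- The entrywise derivative of a matrix-valued superfunction along a vector field. -/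
def VField.actM {n : ℕ} {J : Type} [Fintype J] {N : ℕ} (X : VField n J N) (M : MFun n J N) :
    MFun n J N :=
  fun x => Matrix.of fun r s => X.act (fun y => M y r s) x

/-- The coordinate vector field `∂_k`. -/
def coordField {n : ℕ} {J : Type} [DecidableEq J] {N : ℕ} (k : Fin n ⊕ J) : VField n J N :=
  fun l _ => if l = k then 1 else 0

/-- The bracket `XY + YX` of two odd vector fields. -/
def oddBracket {n : ℕ} {J : Type} [Fintype J] {N : ℕ} (X Y : VField n J N) : VField n J N :=
  fun k x => X.act (Y k) x + Y.act (X k) x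

/-- The parity of a coordinate. -/
def coordParity {n : ℕ} {J : Type} : Fin n ⊕ J → ZMod 2
  | Sum.inl _ => 0
  | Sum.inr _ => 1

/-- `f` is smooth and even on `U`. -/
structure IsEvenOn {n : ℕ} {J : Type} [Fintype J] {N : ℕ} (U : Set (Fin n → ℝ))
    (f : SFun n J N) : Prop where
  smooth : ContDiffOn ℝ ∞ f U
  even : ∀ x ∈ U, f x ∈ parityPart (J ⊕ Fin N) 0

/-- The vector field `∑ f^j D_j`, for a family `D` of vector fields. -/
def comb {n : ℕ} {J K : Type} [Fintype K] {N : ℕ} (D : K → VField n J N) (f : K → SFun n J N) :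
    VField n J N :=
  fun k x => ∑ j, f j x * D j k x

/-! ### Principal `SU(2)`-bundles, sections of the adjoint bundle, connections

The functions are complex-valued, so a morphism from a superdomain to the real manifold `SU(2)` is
a `2 × 2` matrix of even superfunctions with determinant one whose body is unitary, and a
superfunction with values in `su(2)` is a traceless `2 × 2` matrix of superfunctions. -/

/-- A principal `SU(2)`-bundle over a superdomain with body `ℝⁿ`, given by an open cover and by
transition functions, of which only the values on the overlaps matter. -/
structure Bundle (n : ℕ) (J : Type) [Fintype J] (N : ℕ) (I : Type*) where
  U : I → Set (Fin n → ℝ)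
  isOpen : ∀ α, IsOpen (U α)
  cover : ∀ x, ∃ α, x ∈ U α
  g : I → I → MFun n J N
  smooth : ∀ α β r s, ContDiffOn ℝ ∞ (fun x => g α β x r s) (U α ∩ U β)
  even : ∀ α β, ∀ x ∈ U α ∩ U β, ∀ r s, g α β x r s ∈ parityPart (J ⊕ Fin N) 0
  det_one : ∀ α β, ∀ x ∈ U α ∩ U β,
    g α β x 0 0 * g α β x 1 1 - g α β x 0 1 * g α β x 1 0 = 1
  unitary : ∀ α β, ∀ x ∈ U α ∩ U β,
    (g α β x).map (body (J ⊕ Fin N)) ∈ Matrix.specialUnitaryGroup (Fin 2) ℂ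
  refl : ∀ α, ∀ x ∈ U α, g α α x = 1
  cocycle : ∀ α β γ, ∀ x ∈ U α ∩ U β ∩ U γ, g α β x * g β γ x = g α γ x

/-- `M` is a superfunction on `U` of parity `p` with values in `su(2)`. It is extended by zero
outside `U`, so that it is determined by its values on `U`. -/
structure IsLieValued {n : ℕ} {J : Type} [Fintype J] {N : ℕ} (U : Set (Fin n → ℝ)) (p : ZMod 2)
    (M : MFun n J N) : Prop where
  smooth : ∀ r s, ContDiffOn ℝ ∞ (fun x => M x r s) U
  parity : ∀ x r s, M x r s ∈ parityPart (J ⊕ Fin N) p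
  traceless : ∀ x, (M x).trace = 0
  zero_off : ∀ x, x ∉ U → M x = 0

/-- An even section of the adjoint bundle. -/
structure AdSection {n : ℕ} {J : Type} [Fintype J] {N : ℕ} {I : Type*} (P : Bundle n J N I) where
  val : I → MFun n J N
  lieValued : ∀ α, IsLieValued (P.U α) 0 (val α)
  glue : ∀ α β, ∀ x ∈ P.U α ∩ P.U β, val β x = P.g β α x * val α x * P.g α β x

/-- A superconnection on `P`: on each chart an even `su(2)`-valued one-form, given by its
values `pot α k` on the coordinate vector fields, with the usual transformation law
`A_β = g⁻¹ A_α g + g⁻¹ dg`, `g = g_{αβ}`. The covariant derivative on chart `α` is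
`∇_k = ∂_k + pot α k`. -/
structure Connection {n : ℕ} {J : Type} [Fintype J] [DecidableEq J] {N : ℕ} {I : Type*}
    (P : Bundle n J N I) where
  pot : I → Fin n ⊕ J → MFun n J N
  lieValued : ∀ α k, IsLieValued (P.U α) (coordParity k) (pot α k)
  glue : ∀ α β k, ∀ x ∈ P.U α ∩ P.U β,
    pot β k x = P.g β α x * pot α k x * P.g α β x
      + P.g β α x * (coordField (N := N) k).actM (P.g α β) x

/-- The value `A(X)` of the connection form on a vector field, on chart `α`. -/
def Connection.eval {n : ℕ} {J : Type} [Fintype J] [DecidableEq J] {N : ℕ} {I : Type*}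
    {P : Bundle n J N I} (A : Connection P) (α : I) (X : VField n J N) : MFun n J N :=
  fun x => ∑ k, X k x • A.pot α k x

/-- The curvature `F(X, Y) = [∇_X, ∇_Y] - ∇_[X, Y]` on two odd vector fields, on chart `α`:
`F(X, Y) = X(A(Y)) + Y(A(X)) + A(X)A(Y) + A(Y)A(X) - A([X, Y])`. -/
def Connection.oddCurv {n : ℕ} {J : Type} [Fintype J] [DecidableEq J] {N : ℕ} {I : Type*}
    {P : Bundle n J N I} (A : Connection P) (α : I) (X Y : VField n J N) : MFun n J N :=
  fun x => X.actM (A.eval α Y) x + Y.actM (A.eval α X) x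
    + A.eval α X x * A.eval α Y x + A.eval α Y x * A.eval α X x
    - A.eval α (oddBracket X Y) x

/-! ### The two superspaces -/

/-- The antisymmetric symbol, `ε_{12} = 1`. -/
def eps : Matrix (Fin 2) (Fin 2) ℂ := !![0, 1; -1, 0]

/-- The odd coordinates `θ^{ai}` of `E^{6|8}`. -/
abbrev Odd6 : Type := Fin 4 × Fin 2

/-- The odd coordinates of `E^{4|8}`: `inl (a, i)` is `θ^{a(i)}`, `inr (a, i)` is `θ̄^{ȧ(i)}`. -/
abbrev Odd4 : Type := (Fin 2 × Fin 2) ⊕ (Fin 2 × Fin 2)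

/-- The coefficients of `∂_{aḃ} = ∂/∂y^{aḃ}` with respect to the real partial derivatives, where
the `y^{aḃ}` are the complex coordinates on `ℝ⁴` with
`y^{11̇} = x₀ + i x₁`, `y^{22̇} = x₀ - i x₁`, `y^{12̇} = x₂ + i x₃`, `y^{21̇} = -x₂ + i x₃`. -/
def dy4 : Matrix (Fin 2) (Fin 2) (Fin 4 → ℂ) :=
  !![![1 / 2, -Complex.I / 2, 0, 0], ![0, 0, 1 / 2, -Complex.I / 2];
     ![0, 0, -1 / 2, -Complex.I / 2], ![1 / 2, Complex.I / 2, 0, 0]]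

/-- The coefficients of `∂_{ab} = ∂/∂y^{ab}` (`a < b`), with `∂_{ba} = -∂_{ab}`, where the `y^{ab}`
are the complex coordinates on `ℝ⁶` with `y^{13} = x₀ + i x₁`, `y^{24} = x₀ - i x₁`,
`y^{14} = x₂ + i x₃`, `y^{23} = -x₂ + i x₃`, `y^{12} = x₄ + i x₅`, `y^{34} = -x₄ + i x₅`. -/
def dy6 : Matrix (Fin 4) (Fin 4) (Fin 6 → ℂ) :=
  let d12 : Fin 6 → ℂ := ![0, 0, 0, 0, 1 / 2, -Complex.I / 2]
  let d13 : Fin 6 → ℂ := ![1 / 2, -Complex.I / 2, 0, 0, 0, 0]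
  let d14 : Fin 6 → ℂ := ![0, 0, 1 / 2, -Complex.I / 2, 0, 0]
  let d23 : Fin 6 → ℂ := ![0, 0, -1 / 2, -Complex.I / 2, 0, 0]
  let d24 : Fin 6 → ℂ := ![1 / 2, Complex.I / 2, 0, 0, 0, 0]
  let d34 : Fin 6 → ℂ := ![0, 0, 0, 0, -1 / 2, -Complex.I / 2]
  !![0, d12, d13, d14; -d12, 0, d23, d24; -d13, -d23, 0, d34; -d14, -d24, -d34, 0]

/-- The vector field with constant coefficients `c` in the even directions. -/
def constField {n : ℕ} {J : Type} {N : ℕ} (c : Fin n → ℂ) : VField n J N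
  | Sum.inl k => fun _ => algebraMap ℂ _ (c k)
  | Sum.inr _ => fun _ => 0

/-- The left-invariant odd vector fields on `E^{6|8}`,
`D_{ai} = ∂_{ai} - ∑_{b,j} ε_{ij} θ^{bj} ∂_{ab}`. -/
def D6 (N : ℕ) (m : Odd6) : VField 6 Odd6 N
  | Sum.inl k => fun _ => -∑ b, ∑ j, (eps m.2 j * dy6 m.1 b k) • gen (Sum.inl (b, j))
  | Sum.inr l => fun _ => if l = m then 1 else 0

/-- The left-invariant odd vector fields on `E^{4|8}`,
`D_a^{(i)} = ∂_a^{(i)} - ∑_b θ̄^{ḃ(i)} ∂_{aḃ}` and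
`D̄_ȧ^{(i)} = ∂̄_ȧ^{(i)} - ∑_b θ^{b(i)} ∂_{bȧ}`. -/
def D4 (N : ℕ) : Odd4 → VField 4 Odd4 N
  | Sum.inl (a, i) => fun k _ => match k with
    | Sum.inl k => -∑ b, dy4 a b k • gen (Sum.inl (Sum.inr (b, i)))
    | Sum.inr l => if l = Sum.inl (a, i) then 1 else 0
  | Sum.inr (a, i) => fun k _ => match k with
    | Sum.inl k => -∑ b, dy4 b a k • gen (Sum.inl (Sum.inl (b, i)))
    | Sum.inr l => if l = Sum.inr (a, i) then 1 else 0

/-! ### The reduction -/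

/-- The embedding `ℝ⁴ → ℝ⁶` with image `y^{12} = y^{34} = 0`. -/
def embed (x : Fin 4 → ℝ) : Fin 6 → ℝ := ![x 0, x 1, x 2, x 3, 0, 0]

/-- The projection `ℝ⁶ → ℝ⁴` along the directions of `y^{12}` and `y^{34}`. -/
def proj (x : Fin 6 → ℝ) : Fin 4 → ℝ := ![x 0, x 1, x 2, x 3]

/-- The dictionary `D_{ai} = ± D_b^{(j)}` or `± D̄_ḃ^{(j)}` of odd directions; index part:
`D_{11}, D_{12}, D_{21}, D_{22}` correspond to `D_1^{(1)}, D_1^{(2)}, D_2^{(1)}, D_2^{(2)}` and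
`D_{31}, D_{32}, D_{41}, D_{42}` to `-D̄_1^{(2)}, D̄_1^{(1)}, -D̄_2^{(2)}, D̄_2^{(1)}`. -/
def dict : Odd6 → Odd4
  | (0, i) => Sum.inl (0, i)
  | (1, i) => Sum.inl (1, i)
  | (2, i) => Sum.inr (0, 1 - i)
  | (3, i) => Sum.inr (1, 1 - i)

/-- The dictionary of odd directions, sign part. -/
def dictSign : Odd6 → ℂ
  | (2, 0) => -1
  | (3, 0) => -1
  | _ => 1

/-- Pull-back of the odd coordinates from `E^{6|8}` to `E^{4|8}`: `θ^m ↦ ± θ^{dict m}`. -/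
def resOdd (N : ℕ) : Gr (Odd6 ⊕ Fin N) →ₐ[ℂ] Gr (Odd4 ⊕ Fin N) :=
  ExteriorAlgebra.map (Fintype.linearCombination ℂ (fun m => match m with
    | Sum.inl m => dictSign m • Pi.single (Sum.inl (dict m)) (1 : ℂ)
    | Sum.inr s => Pi.single (Sum.inr s) 1))

/-- Pull-back of the odd coordinates from `E^{4|8}` to `E^{6|8}`: `θ^{dict m} ↦ ± θ^m`. -/
def liftOdd (N : ℕ) : Gr (Odd4 ⊕ Fin N) →ₐ[ℂ] Gr (Odd6 ⊕ Fin N) :=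
  ExteriorAlgebra.map (Fintype.linearCombination ℂ (fun l => match l with
    | Sum.inl l => ∑ m, if dict m = l then dictSign m • Pi.single (Sum.inl m) (1 : ℂ) else 0
    | Sum.inr s => Pi.single (Sum.inr s) 1))

/-- Restriction of matrix-valued superfunctions along the embedding `E^{4|8} → E^{6|8}`. -/
def resM {N : ℕ} (M : MFun 6 Odd6 N) : MFun 4 Odd4 N :=
  fun x => (M (embed x)).map (resOdd N)

/-- Pull-back of matrix-valued superfunctions along the projection `E^{6|8} → E^{4|8}`. -/
def liftM {N : ℕ} (M : MFun 4 Odd4 N) : MFun 6 Odd6 N :=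
  fun x => (M (proj x)).map (liftOdd N)

theorem contDiff_proj : ContDiff ℝ ∞ proj := by
  rw [contDiff_pi]
  intro i
  fin_cases i <;> simp [proj] <;> fun_prop

theorem map_mem_parityPart {J K : Type} (L : (J → ℂ) →ₗ[ℂ] (K → ℂ)) {p : ZMod 2} {z : Gr J}
    (hz : z ∈ parityPart J p) : ExteriorAlgebra.map L z ∈ parityPart K p := by
  have key : (parityPart J p).map (ExteriorAlgebra.map L).toLinearMap ≤ parityPart K p := by
    unfold parityPart CliffordAlgebra.evenOdd
    rw [Submodule.map_iSup]
    refine iSup_mono fun n => ?_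
    rw [Submodule.map_pow]
    refine pow_le_pow_left' ?_ _
    rintro _ ⟨_, ⟨v, rfl⟩, rfl⟩
    exact ⟨L v, (ExteriorAlgebra.map_apply_ι L v).symm⟩
  exact key ⟨z, hz, rfl⟩

theorem body_map {J K : Type} (L : (J → ℂ) →ₗ[ℂ] (K → ℂ)) (z : Gr J) :
    body K (ExteriorAlgebra.map L z) = body J z := by
  have key : (body K).comp (ExteriorAlgebra.map L) = body J := by
    apply ExteriorAlgebra.hom_ext
    ext v
    simp [body, ExteriorAlgebra.algebraMapInv]
  exact DFunLike.congr_fun key z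

/-- The pull-back to `E^{6|8}` of a principal bundle over `E^{4|8}`; it is trivial in the
directions of `y^{12}` and `y^{34}`. -/
def Bundle.pullback {N : ℕ} {I : Type*} (P : Bundle 4 Odd4 N I) : Bundle 6 Odd6 N I where
  U α := proj ⁻¹' P.U α
  isOpen α := (P.isOpen α).preimage contDiff_proj.continuous
  cover x := P.cover (proj x)
  g α β := liftM (P.g α β)
  smooth α β r s := by
    have h : ContDiffOn ℝ ∞ ((fun y => P.g α β y r s) ∘ proj)
        (proj ⁻¹' P.U α ∩ proj ⁻¹' P.U β) :=
      (P.smooth α β r s).comp contDiff_proj.contDiffOn (fun x hx => hx)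
    exact (((liftOdd N).toLinearMap.restrictScalars ℝ).toContinuousLinearMap).contDiff.comp_contDiffOn h
  even α β x hx r s := map_mem_parityPart _ (P.even α β (proj x) hx r s)
  det_one α β x hx := by
    have h := congrArg (liftOdd N) (P.det_one α β (proj x) hx)
    simpa [liftM] using h
  unitary α β x hx := by
    have h := P.unitary α β (proj x) hx
    have e : (liftM (P.g α β) x).map (body (Odd6 ⊕ Fin N))
        = (P.g α β (proj x)).map (body (Odd4 ⊕ Fin N)) := by
      ext r s
      exact body_map _ _
    rw [e]
    exact h
  refl α x hx := by
    simp [liftM, P.refl α (proj x) hx]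
  cocycle α β γ x hx := by
    have h := P.cocycle α β γ (proj x) hx
    simp only [liftM]
    rw [← h, Matrix.map_mul]

/-- Invariance under the translations of `ℝ⁶` in the directions of `y^{12}` and `y^{34}`, which act
on the pulled-back bundle. -/
def IsTranslationInvariant {N : ℕ} {I : Type*} {P : Bundle 4 Odd4 N I}
    (A : Connection P.pullback) : Prop :=
  ∀ (α : I) (k : Fin 6 ⊕ Odd6) (x v : Fin 6 → ℝ), proj v = 0 →
    A.pot α k (x + v) = A.pot α k x

/-- A connection on `E^{6|8}` is constrained if its curvature vanishes on all pairs of odd sections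
of the odd distribution, which is spanned by the `D_{ai}`. -/
def IsConstrained {N : ℕ} {I : Type*} {Q : Bundle 6 Odd6 N I} (A : Connection Q) : Prop :=
  ∀ (α : I) (f h : Odd6 → SFun 6 Odd6 N), (∀ m, IsEvenOn (Q.U α) (f m)) →
    (∀ m, IsEvenOn (Q.U α) (h m)) → ∀ x ∈ Q.U α,
      A.oddCurv α (comb (D6 N) f) (comb (D6 N) h) x = 0

/-- The connection `B` on `E^{4|8}` has, along the odd distribution spanned by the `D_a^{(i)}` and
`D̄_ȧ^{(i)}`, only the following curvature, with `S`, `Sbar` sections of the adjoint bundle: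
`F(D_a^{(i)}, D_b^{(j)}) = -ε_{ab} ε_{ij} Sbar`, `F(D̄_ȧ^{(i)}, D̄_ḃ^{(j)}) = -ε_{ab} ε_{ij} S`,
`F(D_a^{(i)}, D̄_ḃ^{(j)}) = 0`; this is written out for arbitrary odd sections of the
distribution. -/
def IsSemiConstrainedWith {N : ℕ} {I : Type*} {P : Bundle 4 Odd4 N I} (B : Connection P)
    (S Sbar : AdSection P) : Prop :=
  ∀ (α : I) (f h : Odd4 → SFun 4 Odd4 N), (∀ m, IsEvenOn (P.U α) (f m)) →
    (∀ m, IsEvenOn (P.U α) (h m)) → ∀ x ∈ P.U α,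
      B.oddCurv α (comb (D4 N) f) (comb (D4 N) h) x =
        (-∑ a, ∑ i, ∑ b, ∑ j, (eps a b * eps i j) •
            (f (Sum.inl (a, i)) x * h (Sum.inl (b, j)) x)) • Sbar.val α x
        + (-∑ a, ∑ i, ∑ b, ∑ j, (eps a b * eps i j) •
            (f (Sum.inr (a, i)) x * h (Sum.inr (b, j)) x)) • S.val α x

/-- A connection on `E^{4|8}` is semi-constrained if its odd-odd curvature is given by two
adjoint-valued scalars. -/
def IsSemiConstrained {N : ℕ} {I : Type*} {P : Bundle 4 Odd4 N I} (B : Connection P) : Prop :=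
  ∃ S Sbar : AdSection P, IsSemiConstrainedWith B S Sbar

/-- `B` is the dimensional reduction of `A`: the covariant derivatives along the left-invariant
fields `D_{ai}` and `∂_{13}, ∂_{14}, ∂_{23}, ∂_{24}` of `E^{6|8}` become those along the
corresponding fields of `E^{4|8}`. -/
structure IsReduction {N : ℕ} {I : Type*} {P : Bundle 4 Odd4 N I} (A : Connection P.pullback)
    (B : Connection P) : Prop where
  odd : ∀ (α : I) (m : Odd6),
    resM (A.eval α (D6 N m)) = dictSign m • B.eval α (D4 N (dict m))
  even13 : ∀ α, resM (A.eval α (constField (dy6 0 2))) = B.eval α (constField (dy4 0 0))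
  even14 : ∀ α, resM (A.eval α (constField (dy6 0 3))) = B.eval α (constField (dy4 0 1))
  even23 : ∀ α, resM (A.eval α (constField (dy6 1 2))) = B.eval α (constField (dy4 1 0))
  even24 : ∀ α, resM (A.eval α (constField (dy6 1 3))) = B.eval α (constField (dy4 1 1))

end SuperConn

end

/-! Call the directions of `y^{12}`, `y^{34}` vertical. A translation-invariant connection `A` on
the pulled-back bundle amounts to its reduction `B` together with its values on the two vertical
directions. The transition functions do not depend on `y^{12}`, `y^{34}`, so these values transform
without an inhomogeneous term: the restrictions of `2A(∂_{34})` and `2A(∂_{12})` are even sections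
`S`, `T` of the adjoint bundle. Thus `A` is equivalent to a triple `(B, S, T)`; `liftConnection`
rebuilds `A` from it, and `connection_eq_of_reduces` shows that nothing is lost.

The constraint translates as follows. Each `D_{ai}` projects, up to sign, to a left-invariant field
on `E^{4|8}` (`isLift_D6`), and `A(D_{ai})` is the pull-back of the value of `B` on the projected
field. Every term of the curvature of `A` on `D_{ai}`, `D_{bj}` is therefore the pull-back of the
corresponding term for `B`, apart from the vertical part of `[D_{ai}, D_{bj}] = -2 ε_{ij} ∂_{ab}`
(`oddCurv_eq`). That part is nonzero only for `∂_{12}`, `∂_{34}` and their negatives, where it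
contributes `2 ε_{ij} A(∂_{ab})`, that is, a scalar `±T` or `±S`. So the curvature of `A` vanishes
on the frame exactly when `B` is semi-constrained with scalars `S`, `T`
(`isConstrained_iff_isSemiConstrainedWith`). Tensoriality (`Connection.oddCurv_comb`) passes between
the frame and arbitrary odd sections.

Finally, a semi-constrained `B` determines its scalars, because each of them is a curvature
component (`IsSemiConstrainedWith.unique`). Hence the triple, and with it `A`, is determined by `B`
alone. -/

noncomputable section

namespace SuperConn

section

/-! ### The Grassmann algebra -/

/-- Even elements are sums of products of pairs of vectors and scalars, and a generator moves past a
pair at the cost of two cancelling signs. -/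
theorem even_mul_comm {J : Type} {g : Gr J} (hg : g ∈ parityPart J 0) (z : Gr J) :
    g * z = z * g := by
  have key : ∀ v w u : J → ℂ, Commute (ExteriorAlgebra.ι ℂ v * ExteriorAlgebra.ι ℂ w)
      (ExteriorAlgebra.ι ℂ u) := by
    intro v w u
    have h1 := eq_neg_of_add_eq_zero_left (ExteriorAlgebra.ι_add_mul_swap (R := ℂ) w u)
    have h2 := eq_neg_of_add_eq_zero_left (ExteriorAlgebra.ι_add_mul_swap (R := ℂ) v u)
    calc ExteriorAlgebra.ι ℂ v * ExteriorAlgebra.ι ℂ w * ExteriorAlgebra.ι ℂ u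
        = -((ExteriorAlgebra.ι ℂ v * ExteriorAlgebra.ι ℂ u) * ExteriorAlgebra.ι ℂ w) := by
          rw [mul_assoc, h1, mul_neg, mul_assoc]
      _ = _ := by rw [h2, neg_mul, neg_neg, mul_assoc]
  have key2 : ∀ (v w : J → ℂ) (y : Gr J), Commute (ExteriorAlgebra.ι ℂ v * ExteriorAlgebra.ι ℂ w)
      y := by
    intro v w y
    induction y using ExteriorAlgebra.induction with
    | algebraMap r => exact Algebra.commute_algebraMap_right r _
    | ι u => exact key v w u
    | mul a b ha hb => exact ha.mul_right hb
    | add a b ha hb => exact ha.add_right hb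
  induction g, hg using CliffordAlgebra.even_induction with
  | algebraMap r => exact Algebra.commutes r z
  | add x y hx hy h1 h2 => rw [add_mul, mul_add, h1, h2]
  | ι_mul_ι_mul v w x hx h => exact (key2 v w z).mul_left (show Commute x z from h)

/-- The graded Leibniz rule carries the sign of the parity of `g`. In the induction `g` is built up
two vectors at a time, so the signs cancel and no grading has to be tracked. -/
theorem contractLeft_even_mul {J : Type} (d : Module.Dual ℂ (J → ℂ)) {g : Gr J}
    (hg : g ∈ parityPart J 0) (z : Gr J) :
    CliffordAlgebra.contractLeft d (g * z)
      = CliffordAlgebra.contractLeft d g * z + g * CliffordAlgebra.contractLeft d z := by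
  induction g, hg using CliffordAlgebra.even_induction with
  | algebraMap r =>
    rw [CliffordAlgebra.contractLeft_algebraMap_mul, CliffordAlgebra.contractLeft_algebraMap,
      zero_mul, zero_add]
  | add x y hx hy h1 h2 => simp only [add_mul, map_add, h1, h2]; abel
  | ι_mul_ι_mul v w x hx h =>
    simp only [mul_assoc, CliffordAlgebra.contractLeft_ι_mul, h]
    simp only [mul_sub, sub_mul, mul_add, mul_assoc, smul_mul_assoc]
    abel

/-- The chain rule for a linear substitution of the odd coordinates: the covector is pulled back by
the transpose of `L`. -/
theorem contractLeft_map {J K : Type} (L : (J → ℂ) →ₗ[ℂ] (K → ℂ)) (d : Module.Dual ℂ (K → ℂ))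
    (z : Gr J) :
    CliffordAlgebra.contractLeft d (ExteriorAlgebra.map L z)
      = ExteriorAlgebra.map L (CliffordAlgebra.contractLeft (d ∘ₗ L) z) := by
  induction z using CliffordAlgebra.left_induction with
  | algebraMap r =>
    rw [CliffordAlgebra.contractLeft_algebraMap, map_zero, AlgHom.commutes]
    exact CliffordAlgebra.contractLeft_algebraMap _ _ _
  | add x y hx hy => simp only [map_add, hx, hy]
  | ι_mul x v h =>
    have e : ExteriorAlgebra.map L (CliffordAlgebra.ι (0 : QuadraticForm ℂ (J → ℂ)) v)
        = CliffordAlgebra.ι (0 : QuadraticForm ℂ (K → ℂ)) (L v) :=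
      ExteriorAlgebra.map_apply_ι L v
    rw [map_mul, e, CliffordAlgebra.contractLeft_ι_mul, CliffordAlgebra.contractLeft_ι_mul, h,
      map_sub, map_mul, e, map_smul]
    rfl

theorem contractLeft_gen {J : Type} [DecidableEq J] (i j : J) :
    CliffordAlgebra.contractLeft (LinearMap.proj i) (gen j) = if i = j then (1 : Gr J) else 0 := by
  have := CliffordAlgebra.contractLeft_ι (Q := (0 : QuadraticForm ℂ (J → ℂ)))
    (LinearMap.proj i) (Pi.single j 1)
  refine this.trans ?_
  by_cases h : i = j <;> simp [h, LinearMap.proj]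

theorem gen_mem_parityPart {J : Type} [DecidableEq J] (j : J) : gen j ∈ parityPart J 1 :=
  CliffordAlgebra.ι_mem_evenOdd_one _ _

/-! ### Derivatives of superfunctions -/

/-- Multiplication of the Grassmann algebra as a continuous bilinear map over the reals. -/
def mulL (J : Type) [Fintype J] : Gr J →L[ℝ] Gr J →L[ℝ] Gr J :=
  have : FiniteDimensional ℝ (Gr J) := FiniteDimensional.complexToReal _
  (LinearMap.mul ℝ (Gr J)).toContinuousBilinearMap

theorem mulL_apply (J : Type) [Fintype J] (a b : Gr J) : mulL J a b = a * b := rfl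

variable {n : ℕ} {J : Type} [Fintype J] {N : ℕ}

theorem differentiableAt_mul {f h : SFun n J N} {x : Fin n → ℝ} (hf : DifferentiableAt ℝ f x)
    (hh : DifferentiableAt ℝ h x) : DifferentiableAt ℝ (fun y => f y * h y) x :=
  ((mulL (J ⊕ Fin N)).hasFDerivAt_of_bilinear hf.hasFDerivAt hh.hasFDerivAt).differentiableAt

theorem contDiffOn_const_mul {f : SFun n J N} {U : Set (Fin n → ℝ)} (c : Gr (J ⊕ Fin N))
    (hf : ContDiffOn ℝ ∞ f U) : ContDiffOn ℝ ∞ (fun y => c * f y) U :=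
  (mulL (J ⊕ Fin N) c).contDiff.comp_contDiffOn hf

theorem pder_mul {f h : SFun n J N} {x : Fin n → ℝ} (hf : DifferentiableAt ℝ f x)
    (hh : DifferentiableAt ℝ h x) (hf0 : f x ∈ parityPart (J ⊕ Fin N) 0) (k : Fin n ⊕ J) :
    pder k (fun y => f y * h y) x = pder k f x * h x + f x * pder k h x := by
  cases k with
  | inl k =>
    have := ((mulL (J ⊕ Fin N)).hasFDerivAt_of_bilinear hf.hasFDerivAt hh.hasFDerivAt).fderiv
    simp only [mulL_apply] at this
    simp only [pder, this]
    simp only [add_apply, ContinuousLinearMap.precompR_apply,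
      ContinuousLinearMap.precompL_apply, mulL_apply]
    exact add_comm _ _
  | inr j => exact contractLeft_even_mul _ hf0 _

theorem pder_sum {ι : Type*} (s : Finset ι) {f : ι → SFun n J N} {x : Fin n → ℝ}
    (hf : ∀ i ∈ s, DifferentiableAt ℝ (f i) x) (k : Fin n ⊕ J) :
    pder k (fun y => ∑ i ∈ s, f i y) x = ∑ i ∈ s, pder k (f i) x := by
  cases k with
  | inl k =>
    simp only [pder]
    rw [fderiv_fun_sum hf, sum_apply]
  | inr j => simp only [pder, map_sum]

theorem pder_const (c : Gr (J ⊕ Fin N)) (k : Fin n) (x : Fin n → ℝ) :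
    pder (Sum.inl k : Fin n ⊕ J) (fun _ => c) x = 0 := by
  simp [pder]

theorem VField.act_mul (X : VField n J N) {f h : SFun n J N} {x : Fin n → ℝ}
    (hf : DifferentiableAt ℝ f x) (hh : DifferentiableAt ℝ h x)
    (hf0 : f x ∈ parityPart (J ⊕ Fin N) 0) :
    X.act (fun y => f y * h y) x = X.act f x * h x + f x * X.act h x := by
  simp only [VField.act, pder_mul hf hh hf0, mul_add, Finset.sum_add_distrib, Finset.sum_mul,
    ← mul_assoc, even_mul_comm hf0]

theorem VField.act_sum {ι : Type*} (s : Finset ι) (X : VField n J N) {f : ι → SFun n J N}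
    {x : Fin n → ℝ} (hf : ∀ i ∈ s, DifferentiableAt ℝ (f i) x) :
    X.act (fun y => ∑ i ∈ s, f i y) x = ∑ i ∈ s, X.act (f i) x := by
  simp only [VField.act, pder_sum s hf, Finset.mul_sum]
  exact Finset.sum_comm

theorem comb_act {K : Type} [Fintype K] (D : K → VField n J N) (f : K → SFun n J N)
    (φ : SFun n J N) (x : Fin n → ℝ) :
    (comb D f).act φ x = ∑ j, f j x * (D j).act φ x := by
  simp only [VField.act, comb, Finset.sum_mul, Finset.mul_sum, mul_assoc]
  exact Finset.sum_comm

theorem VField.actM_sum_smul {ι : Type*} (s : Finset ι) (X : VField n J N) {f : ι → SFun n J N}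
    {M : ι → MFun n J N} {x : Fin n → ℝ} (hf : ∀ i ∈ s, DifferentiableAt ℝ (f i) x)
    (hM : ∀ i ∈ s, ∀ r t, DifferentiableAt ℝ (fun y => M i y r t) x)
    (hf0 : ∀ i ∈ s, f i x ∈ parityPart (J ⊕ Fin N) 0) :
    X.actM (fun y => ∑ i ∈ s, f i y • M i y) x
      = ∑ i ∈ s, (X.act (f i) x • M i x + f i x • X.actM (M i) x) := by
  ext r t
  simp only [VField.actM, Matrix.of_apply, Matrix.sum_apply, Matrix.smul_apply, Matrix.add_apply,
    smul_eq_mul]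
  rw [X.act_sum s fun i hi => differentiableAt_mul (hf i hi) (hM i hi r t)]
  exact Finset.sum_congr rfl fun i hi => X.act_mul (hf i hi) (hM i hi r t) (hf0 i hi)

theorem comb_actM {K : Type} [Fintype K] (D : K → VField n J N) (f : K → SFun n J N)
    (M : MFun n J N) (x : Fin n → ℝ) :
    (comb D f).actM M x = ∑ j, f j x • (D j).actM M x := by
  ext r t
  simp only [VField.actM, Matrix.of_apply, Matrix.sum_apply, Matrix.smul_apply, smul_eq_mul,
    comb_act]

/-- Only `h` has to pass the entries of `A`, so `f` may have any parity. -/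
theorem smul_mul_smul_even {J : Type} {f h : Gr J} (hh : h ∈ parityPart J 0)
    (A B : Matrix (Fin 2) (Fin 2) (Gr J)) : (f • A) * (h • B) = (f * h) • (A * B) := by
  ext r t
  simp only [Matrix.mul_apply, Matrix.smul_apply, smul_eq_mul, Finset.mul_sum]
  refine Finset.sum_congr rfl fun i _ => ?_
  rw [mul_assoc, ← mul_assoc (A r i), ← even_mul_comm hh, mul_assoc, mul_assoc]

/-! ### Tensoriality of the curvature -/

variable [DecidableEq J] {I : Type*} {P : Bundle n J N I}

theorem Connection.differentiableAt_pot (A : Connection P) (α : I) (k : Fin n ⊕ J)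
    {x : Fin n → ℝ} (hx : x ∈ P.U α) (r t : Fin 2) :
    DifferentiableAt ℝ (fun y => A.pot α k y r t) x :=
  (((A.lieValued α k).smooth r t).contDiffAt ((P.isOpen α).mem_nhds hx)).differentiableAt (by simp)

theorem Connection.differentiableAt_eval (A : Connection P) (α : I) {X : VField n J N}
    {x : Fin n → ℝ} (hx : x ∈ P.U α) (hX : ∀ k, DifferentiableAt ℝ (X k) x) (r t : Fin 2) :
    DifferentiableAt ℝ (fun y => A.eval α X y r t) x := by
  simp only [Connection.eval, Matrix.sum_apply, Matrix.smul_apply, smul_eq_mul]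
  exact DifferentiableAt.fun_sum fun k _ =>
    differentiableAt_mul (hX k) (A.differentiableAt_pot α k hx r t)

theorem Connection.eval_comb {K : Type} [Fintype K] (A : Connection P) (α : I)
    (D : K → VField n J N) (f : K → SFun n J N) :
    A.eval α (comb D f) = fun x => ∑ j, f j x • A.eval α (D j) x := by
  funext x
  simp only [Connection.eval, comb, Finset.sum_smul, Finset.smul_sum, smul_smul]
  exact Finset.sum_comm

/-- The terms of `X(A(Y)) + Y(A(X))` that differentiate the coefficients are exactly those produced
by `A([X, Y])`. All coefficients are even, so no signs intervene. -/
theorem Connection.oddCurv_comb {K : Type} [Fintype K] (A : Connection P) (α : I)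
    {D : K → VField n J N} {f h : K → SFun n J N} {x : Fin n → ℝ} (hx : x ∈ P.U α)
    (hD : ∀ j k, DifferentiableAt ℝ (D j k) x)
    (hf : ∀ j, DifferentiableAt ℝ (f j) x) (hh : ∀ j, DifferentiableAt ℝ (h j) x)
    (hf0 : ∀ j, f j x ∈ parityPart (J ⊕ Fin N) 0)
    (hh0 : ∀ j, h j x ∈ parityPart (J ⊕ Fin N) 0) :
    A.oddCurv α (comb D f) (comb D h) x
      = ∑ i, ∑ j, (f i x * h j x) • A.oddCurv α (D i) (D j) x := by
  have hE : ∀ j r t, DifferentiableAt ℝ (fun y => A.eval α (D j) y r t) x :=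
    fun j => A.differentiableAt_eval α hx (hD j)
  have act_comb : ∀ (X : VField n J N) (u : K → SFun n J N),
      (∀ j, DifferentiableAt ℝ (u j) x) → (∀ j, u j x ∈ parityPart (J ⊕ Fin N) 0) → ∀ k,
      X.act (comb D u k) x = ∑ j, (X.act (u j) x * D j k x + u j x * X.act (D j k) x) := by
    intro X u hu hu0 k
    refine (X.act_sum Finset.univ fun j _ => differentiableAt_mul (hu j) (hD j k)).trans ?_
    exact Finset.sum_congr rfl fun j _ => X.act_mul (hu j) (hD j k) (hu0 j)
  have bracket : A.eval α (oddBracket (comb D f) (comb D h)) x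
      = ∑ i, ∑ j, (f i x • (D i).act (h j) x • A.eval α (D j) x
        + h j x • (D j).act (f i) x • A.eval α (D i) x
        + (f i x * h j x) • A.eval α (oddBracket (D i) (D j)) x) := by
    have : ∀ k, oddBracket (comb D f) (comb D h) k x
        = ∑ i, ∑ j, (f i x * ((D i).act (h j) x * D j k x) + h j x * ((D j).act (f i) x * D i k x)
          + (f i x * h j x) * oddBracket (D i) (D j) k x) := by
      intro k
      have half : ∀ u v : K → SFun n J N, (∀ j, DifferentiableAt ℝ (v j) x) →
          (∀ j, v j x ∈ parityPart (J ⊕ Fin N) 0) →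
          (comb D u).act (comb D v k) x = ∑ i, ∑ j, (u i x * ((D i).act (v j) x * D j k x)
            + u i x * v j x * (D i).act (D j k) x) := by
        intro u v hv hv0
        rw [comb_act]
        refine Finset.sum_congr rfl fun i _ => ?_
        rw [act_comb _ v hv hv0, Finset.mul_sum]
        simp only [mul_add, mul_assoc]
      rw [oddBracket, half f h hh hh0, half h f hf hf0,
        Finset.sum_comm (f := fun i j => h i x * ((D i).act (f j) x * D j k x) + _),
        ← Finset.sum_add_distrib]
      refine Finset.sum_congr rfl fun i _ => ?_
      rw [← Finset.sum_add_distrib]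
      refine Finset.sum_congr rfl fun j _ => ?_
      rw [oddBracket, mul_add, even_mul_comm (hh0 j) (f i x)]
      abel
    simp only [Connection.eval, this, Finset.sum_smul, Finset.smul_sum, ← Finset.sum_add_distrib]
    rw [Finset.sum_comm]
    refine Finset.sum_congr rfl fun i _ => ?_
    rw [Finset.sum_comm]
    refine Finset.sum_congr rfl fun j _ => Finset.sum_congr rfl fun k _ => ?_
    simp only [add_smul, smul_smul]
  have e1 : ∀ u v : K → SFun n J N, (∀ j, DifferentiableAt ℝ (v j) x) →
      (∀ j, v j x ∈ parityPart (J ⊕ Fin N) 0) →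
      (comb D u).actM (A.eval α (comb D v)) x = ∑ i, ∑ j,
        (u i x • (D i).act (v j) x • A.eval α (D j) x
          + (u i x * v j x) • (D i).actM (A.eval α (D j)) x) := by
    intro u v hv hv0
    rw [comb_actM, A.eval_comb]
    refine Finset.sum_congr rfl fun i _ => ?_
    rw [(D i).actM_sum_smul Finset.univ (fun j _ => hv j) (fun j _ => hE j) (fun j _ => hv0 j),
      Finset.smul_sum]
    refine Finset.sum_congr rfl fun j _ => ?_
    rw [smul_add, smul_smul (u i x) (v j x)]
  have e2 : ∀ u v : K → SFun n J N, (∀ j, v j x ∈ parityPart (J ⊕ Fin N) 0) →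
      A.eval α (comb D u) x * A.eval α (comb D v) x
        = ∑ i, ∑ j, (u i x * v j x) • (A.eval α (D i) x * A.eval α (D j) x) := by
    intro u v hv0
    simp only [A.eval_comb, Finset.sum_mul_sum, smul_mul_smul_even (hv0 _)]
  -- Exchanging the summations where `h` stands first makes the outer index belong to `f`
  -- everywhere; the derivative terms then cancel summand by summand.
  rw [Connection.oddCurv, bracket, e1 f h hh hh0, e1 h f hf hf0, e2 f h hh0, e2 h f hf0,
    Finset.sum_comm (f := fun i j => h i x • (D i).act (f j) x • A.eval α (D j) x + _),
    Finset.sum_comm (f := fun i j => (h i x * f j x) • (A.eval α (D i) x * A.eval α (D j) x))]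
  simp only [← Finset.sum_add_distrib, ← Finset.sum_sub_distrib]
  refine Finset.sum_congr rfl fun i _ => Finset.sum_congr rfl fun j _ => ?_
  simp only [Connection.oddCurv, smul_sub, smul_add, even_mul_comm (hh0 j) (f i x)]
  abel

end

section

/-! ### Restriction and pull-back -/

theorem proj_embed (x : Fin 4 → ℝ) : proj (embed x) = x := by
  funext i
  fin_cases i <;> rfl

/-- The inverse of `dict`. -/
def undict : Odd4 → Odd6
  | Sum.inl (0, i) => (0, i)
  | Sum.inl (1, i) => (1, i)
  | Sum.inr (0, i) => (2, 1 - i)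
  | Sum.inr (1, i) => (3, 1 - i)

theorem dict_undict (l : Odd4) : dict (undict l) = l := by
  revert l; decide

theorem undict_dict (m : Odd6) : undict (dict m) = m := by
  revert m; decide

theorem dict_injective : Function.Injective dict :=
  Function.LeftInverse.injective undict_dict

/-- `dict` as a bijection. -/
def dictEquiv : Odd6 ≃ Odd4 := ⟨dict, undict, undict_dict, dict_undict⟩

theorem dictSign_mul_self (m : Odd6) : dictSign m * dictSign m = 1 := by
  obtain ⟨a, i⟩ := m
  fin_cases a <;> fin_cases i <;> simp [dictSign]

variable {N : ℕ}

theorem liftOdd_gen_inl (m : Odd6) :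
    liftOdd N (gen (Sum.inl (dict m))) = dictSign m • gen (Sum.inl m) := by
  rw [gen, liftOdd, ExteriorAlgebra.map_apply_ι, gen, ← map_smul]
  congr 1
  simp [Fintype.linearCombination_apply_single, dict_injective.eq_iff]

theorem liftOdd_gen_inr (s : Fin N) : liftOdd N (gen (Sum.inr s)) = gen (Sum.inr s) := by
  rw [gen, liftOdd, ExteriorAlgebra.map_apply_ι, gen]
  congr 1
  simp [Fintype.linearCombination_apply_single]

theorem resOdd_gen_inl (m : Odd6) :
    resOdd N (gen (Sum.inl m)) = dictSign m • gen (Sum.inl (dict m)) := by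
  rw [gen, resOdd, ExteriorAlgebra.map_apply_ι, gen, ← map_smul]
  congr 1
  simp [Fintype.linearCombination_apply_single]

theorem resOdd_gen_inr (s : Fin N) : resOdd N (gen (Sum.inr s)) = gen (Sum.inr s) := by
  rw [gen, resOdd, ExteriorAlgebra.map_apply_ι, gen]
  congr 1
  simp [Fintype.linearCombination_apply_single]

theorem gr_algHom_ext {J : Type} [Finite J] [DecidableEq J] {R : Type*} [Ring R] [Algebra ℂ R]
    {φ ψ : Gr J →ₐ[ℂ] R} (h : ∀ j, φ (gen j) = ψ (gen j)) : φ = ψ := by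
  apply ExteriorAlgebra.hom_ext
  apply LinearMap.pi_ext'
  intro j
  apply LinearMap.ext_ring
  exact h j

/-- Both maps permute the generators up to the same signs, which square to one. -/
theorem resOdd_liftOdd (z : Gr (Odd4 ⊕ Fin N)) : resOdd N (liftOdd N z) = z := by
  have : (resOdd N).comp (liftOdd N) = AlgHom.id ℂ _ := by
    apply gr_algHom_ext
    rintro (l | s)
    · obtain ⟨m, rfl⟩ := dictEquiv.surjective l
      change resOdd N (liftOdd N (gen (Sum.inl (dict m)))) = gen (Sum.inl (dict m))
      rw [liftOdd_gen_inl, map_smul, resOdd_gen_inl, smul_smul, dictSign_mul_self, one_smul]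
    · simp [liftOdd_gen_inr, resOdd_gen_inr]
  exact DFunLike.congr_fun this z

theorem liftOdd_resOdd (z : Gr (Odd6 ⊕ Fin N)) : liftOdd N (resOdd N z) = z := by
  have : (liftOdd N).comp (resOdd N) = AlgHom.id ℂ _ := by
    apply gr_algHom_ext
    rintro (m | s)
    · simp [resOdd_gen_inl, liftOdd_gen_inl, smul_smul, dictSign_mul_self]
    · simp [liftOdd_gen_inr, resOdd_gen_inr]
  exact DFunLike.congr_fun this z

theorem resM_liftM (M : MFun 4 Odd4 N) : resM (liftM M) = M := by
  funext x
  ext r t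
  simp [resM, liftM, proj_embed, resOdd_liftOdd]

/-- Superfunctions that are constant along the fibres of `proj` are pull-backs. -/
theorem liftM_resM {M : MFun 6 Odd6 N} (h : ∀ x v, proj v = 0 → M (x + v) = M x) :
    liftM (resM M) = M := by
  funext x
  have e : M (embed (proj x)) = M x := by
    have := h x (embed (proj x) - x) (by
      funext i
      fin_cases i <;> simp [proj, embed])
    rwa [add_sub_cancel] at this
  ext r t
  simp [resM, liftM, liftOdd_resOdd, e]

theorem liftM_translate (M : MFun 4 Odd4 N) (x v : Fin 6 → ℝ) (hv : proj v = 0) :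
    liftM M (x + v) = liftM M x := by
  have : proj (x + v) = proj x := by
    funext i
    have := congrFun hv i
    fin_cases i <;> simpa [proj] using this
  simp [liftM, this]

theorem map_liftOdd_smul (c : Gr (Odd4 ⊕ Fin N)) (M : Matrix (Fin 2) (Fin 2) (Gr (Odd4 ⊕ Fin N))) :
    (c • M).map (liftOdd N) = liftOdd N c • M.map (liftOdd N) := by
  ext r t
  simp

theorem map_resOdd_smul (c : Gr (Odd6 ⊕ Fin N)) (M : Matrix (Fin 2) (Fin 2) (Gr (Odd6 ⊕ Fin N))) :
    (c • M).map (resOdd N) = resOdd N c • M.map (resOdd N) := by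
  ext r t
  simp

theorem map_liftOdd_sum {ι : Type*} (s : Finset ι)
    (M : ι → Matrix (Fin 2) (Fin 2) (Gr (Odd4 ⊕ Fin N))) :
    (∑ i ∈ s, M i).map (liftOdd N) = ∑ i ∈ s, (M i).map (liftOdd N) := by
  ext r t
  simp [Matrix.sum_apply]

theorem map_resOdd_sum {ι : Type*} (s : Finset ι)
    (M : ι → Matrix (Fin 2) (Fin 2) (Gr (Odd6 ⊕ Fin N))) :
    (∑ i ∈ s, M i).map (resOdd N) = ∑ i ∈ s, (M i).map (resOdd N) := by
  ext r t
  simp [Matrix.sum_apply]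

theorem contDiff_embed : ContDiff ℝ ∞ embed := by
  rw [contDiff_pi]
  intro i
  fin_cases i <;> simp [embed] <;> fun_prop

theorem IsLieValued.res {U : Set (Fin 4 → ℝ)} {p : ZMod 2} {M : MFun 6 Odd6 N}
    (h : IsLieValued (proj ⁻¹' U) p M) : IsLieValued U p (resM M) where
  smooth r s := by
    have h1 : ContDiffOn ℝ ∞ ((fun y => M y r s) ∘ embed) U :=
      (h.smooth r s).comp contDiff_embed.contDiffOn (fun x hx => by
        simpa [proj_embed] using hx)
    exact (((resOdd N).toLinearMap.restrictScalars ℝ).toContinuousLinearMap).contDiff.comp_contDiffOn h1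
  parity x r s := map_mem_parityPart _ (h.parity _ r s)
  traceless x := by
    have := congrArg (resOdd N) (h.traceless (embed x))
    simpa [resM, Matrix.trace] using this
  zero_off x hx := by
    have := h.zero_off (embed x) (by simpa [proj_embed] using hx)
    simp [resM, this]

theorem IsLieValued.lift {U : Set (Fin 4 → ℝ)} {p : ZMod 2} {M : MFun 4 Odd4 N}
    (h : IsLieValued U p M) : IsLieValued (proj ⁻¹' U) p (liftM M) where
  smooth r s := by
    have h1 : ContDiffOn ℝ ∞ ((fun y => M y r s) ∘ proj) (proj ⁻¹' U) :=
      (h.smooth r s).comp contDiff_proj.contDiffOn (fun x hx => hx)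
    exact (((liftOdd N).toLinearMap.restrictScalars ℝ).toContinuousLinearMap).contDiff.comp_contDiffOn h1
  parity x r s := map_mem_parityPart _ (h.parity _ r s)
  traceless x := by
    have := congrArg (liftOdd N) (h.traceless (proj x))
    simpa [liftM, Matrix.trace] using this
  zero_off x hx := by
    have := h.zero_off (proj x) hx
    simp [liftM, this]

theorem smul_mul_even {J : Type} {c : Gr J} {G M : Matrix (Fin 2) (Fin 2) (Gr J)}
    (hG : ∀ r s, G r s ∈ parityPart J 0) : c • (G * M) = G * (c • M) := by
  ext r t
  simp only [Matrix.mul_apply, Matrix.smul_apply, smul_eq_mul, Finset.mul_sum]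
  refine Finset.sum_congr rfl fun i _ => ?_
  rw [← mul_assoc, ← even_mul_comm (hG r i), mul_assoc]

/-! ### Operations on Lie-algebra-valued superfunctions, and gluing along arbitrary fields -/

section LieValued

variable {n : ℕ} {J : Type} [Fintype J] {U : Set (Fin n → ℝ)} {p : ZMod 2} {M M' : MFun n J N}

theorem IsLieValued.const_mul {q : ZMod 2} {c : Gr (J ⊕ Fin N)} (hc : c ∈ parityPart _ q)
    (h : IsLieValued U p M) : IsLieValued U (q + p) (fun x => c • M x) where
  smooth r s := contDiffOn_const_mul c (h.smooth r s)
  parity x r s := SetLike.mul_mem_graded hc (h.parity x r s)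
  traceless x := by rw [Matrix.trace_smul, h.traceless, smul_zero]
  zero_off x hx := by rw [h.zero_off x hx, smul_zero]

theorem IsLieValued.const_smul (c : ℂ) (h : IsLieValued U p M) :
    IsLieValued U p (c • M) where
  smooth r s := (h.smooth r s).const_smul c
  parity x r s := Submodule.smul_mem _ c (h.parity x r s)
  traceless x := by rw [Pi.smul_apply, Matrix.trace_smul, h.traceless, smul_zero]
  zero_off x hx := by rw [Pi.smul_apply, h.zero_off x hx, smul_zero]

theorem IsLieValued.add (h : IsLieValued U p M) (h' : IsLieValued U p M') :
    IsLieValued U p (M + M') where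
  smooth r s := (h.smooth r s).add (h'.smooth r s)
  parity x r s := Submodule.add_mem _ (h.parity x r s) (h'.parity x r s)
  traceless x := by rw [Pi.add_apply, Matrix.trace_add, h.traceless, h'.traceless, add_zero]
  zero_off x hx := by rw [Pi.add_apply, h.zero_off x hx, h'.zero_off x hx, add_zero]

theorem IsLieValued.zero : IsLieValued U p (0 : MFun n J N) where
  smooth r s := contDiffOn_const
  parity x r s := Submodule.zero_mem _
  traceless x := by simp
  zero_off x hx := rfl

theorem IsLieValued.sum {ι : Type*} (s : Finset ι) {F : ι → MFun n J N}
    (h : ∀ i ∈ s, IsLieValued U p (F i)) : IsLieValued U p (∑ i ∈ s, F i) :=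
  Finset.sum_induction F (IsLieValued U p) (fun _ _ => IsLieValued.add) IsLieValued.zero h

variable [DecidableEq J] {I : Type*} {P : Bundle n J N I}

/-- The parity of `k` enters twice, through the coefficient and through the potential, and cancels
modulo two. -/
theorem Connection.lieValued_eval (A : Connection P) (α : I) {X : VField n J N} {p : ZMod 2}
    (c : Fin n ⊕ J → Gr (J ⊕ Fin N)) (hX : ∀ k x, X k x = c k)
    (hc : ∀ k, c k ∈ parityPart (J ⊕ Fin N) (p + coordParity k)) :
    IsLieValued (P.U α) p (A.eval α X) := by
  have e : A.eval α X = ∑ k, fun x => c k • A.pot α k x := by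
    funext x
    simp only [Connection.eval, hX, Finset.sum_apply]
  rw [e]
  refine IsLieValued.sum _ fun k _ => ?_
  have := (A.lieValued α k).const_mul (hc k)
  rwa [add_assoc, show coordParity k + coordParity k = 0 from by
    cases k
    · exact add_zero _
    · exact CharTwo.add_self_eq_zero _, add_zero] at this

theorem actM_coordField (k : Fin n ⊕ J) (M : MFun n J N) (x : Fin n → ℝ) :
    (coordField (N := N) k).actM M x = Matrix.of fun r s => pder k (fun y => M y r s) x := by
  ext r s
  simp [VField.actM, VField.act, coordField]

theorem VField.actM_eq_sum (X : VField n J N) (M : MFun n J N) (x : Fin n → ℝ) :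
    X.actM M x = ∑ k, X k x • (coordField (N := N) k).actM M x := by
  simp only [actM_coordField]
  ext r s
  simp [VField.actM, VField.act, Matrix.sum_apply]

/-- The gauge law extends from coordinate fields to all fields by linearity: the transition
functions are even, so the coefficients of `X`, of either parity, pass through them. -/
theorem Connection.eval_glue (A : Connection P) (α β : I) (X : VField n J N) {x : Fin n → ℝ}
    (hx : x ∈ P.U α ∩ P.U β) :
    A.eval β X x = P.g β α x * A.eval α X x * P.g α β x + P.g β α x * X.actM (P.g α β) x := by
  have hg := P.even β α x hx.symm
  simp only [Connection.eval, A.glue α β _ x hx, X.actM_eq_sum, smul_add, Finset.sum_add_distrib,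
    Finset.mul_sum, Finset.sum_mul]
  congr 1
  · refine Finset.sum_congr rfl fun k _ => ?_
    rw [← smul_mul_assoc, smul_mul_even hg]
  · exact Finset.sum_congr rfl fun k _ => smul_mul_even hg

end LieValued

/-! ### Derivatives of pull-backs -/

/-- By `contractLeft_map` it suffices to compare two covectors on the generators. -/
theorem contractLeft_liftOdd_inr (m : Odd6) (z : Gr (Odd4 ⊕ Fin N)) :
    CliffordAlgebra.contractLeft (LinearMap.proj (Sum.inl m)) (liftOdd N z)
      = dictSign m • liftOdd N
        (CliffordAlgebra.contractLeft (LinearMap.proj (Sum.inl (dict m))) z) := by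
  rw [liftOdd, contractLeft_map, ← map_smul, ← LinearMap.smul_apply, ← map_smul]
  congr 3
  apply LinearMap.pi_ext'
  intro j
  apply LinearMap.ext_ring
  rcases j with l | s
  · obtain ⟨m', rfl⟩ := dictEquiv.surjective l
    change _ = (dictSign m • LinearMap.proj (R := ℂ) (φ := fun _ => ℂ) (Sum.inl (dict m)))
      (Pi.single (Sum.inl (dict m')) 1)
    by_cases h : m = m'
    · subst h
      simp [Fintype.linearCombination_apply_single, dictEquiv, dict_injective.eq_iff]
    · have h' : dict m ≠ dict m' := fun e => h (dict_injective e)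
      simp [Fintype.linearCombination_apply_single, dictEquiv, dict_injective.eq_iff, h]
  · simp [Fintype.linearCombination_apply_single]

/-- The projection `ℝ⁶ → ℝ⁴` as a continuous linear map. -/
def projL : (Fin 6 → ℝ) →L[ℝ] (Fin 4 → ℝ) :=
  ContinuousLinearMap.pi fun k => ContinuousLinearMap.proj (Fin.castAdd 2 k)

theorem projL_apply (x : Fin 6 → ℝ) : projL x = proj x := by
  funext k
  fin_cases k <;> rfl

theorem fderiv_lift {φ : SFun 4 Odd4 N} {x : Fin 6 → ℝ} (h : DifferentiableAt ℝ φ (proj x))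
    (v : Fin 6 → ℝ) :
    fderiv ℝ (fun y => liftOdd N (φ (proj y))) x v
      = liftOdd N (fderiv ℝ φ (proj x) (proj v)) := by
  have h1 : HasFDerivAt (fun y => φ (proj y)) ((fderiv ℝ φ (proj x)).comp projL) x := by
    have h2 : HasFDerivAt φ (fderiv ℝ φ (projL x)) (projL x) := by
      rw [projL_apply]; exact h.hasFDerivAt
    have := h2.comp x projL.hasFDerivAt
    simpa only [Function.comp_def, projL_apply] using this
  have h3 := (((liftOdd N).toLinearMap.restrictScalars ℝ).toContinuousLinearMap).hasFDerivAt.comp x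
    h1
  have h4 := congrArg (fun L => L v) h3.fderiv
  simpa [Function.comp_def, projL_apply] using h4

theorem pder_lift_castAdd {φ : SFun 4 Odd4 N} {x : Fin 6 → ℝ} (h : DifferentiableAt ℝ φ (proj x))
    (k : Fin 4) :
    pder (Sum.inl (Fin.castAdd 2 k)) (fun y => liftOdd N (φ (proj y))) x
      = liftOdd N (pder (Sum.inl k) φ (proj x)) := by
  simp only [pder]
  rw [fderiv_lift h]
  congr 2
  funext i
  fin_cases k <;> fin_cases i <;> simp [proj]

theorem pder_lift_natAdd {φ : SFun 4 Odd4 N} {x : Fin 6 → ℝ} (h : DifferentiableAt ℝ φ (proj x))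
    (k : Fin 2) :
    pder (Sum.inl (Fin.natAdd 4 k)) (fun y => liftOdd N (φ (proj y))) x = 0 := by
  simp only [pder]
  rw [fderiv_lift h]
  have : proj (Pi.single (Fin.natAdd 4 k) 1) = 0 := by
    funext i
    fin_cases k <;> fin_cases i <;> simp [proj]
  rw [this]
  simp

theorem pder_lift_inr (φ : SFun 4 Odd4 N) (x : Fin 6 → ℝ) (m : Odd6) :
    pder (Sum.inr m) (fun y => liftOdd N (φ (proj y))) x
      = dictSign m • liftOdd N (pder (Sum.inr (dict m)) φ (proj x)) :=
  contractLeft_liftOdd_inr m _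

/-- The vector field `X` on `E^{6|8}` projects to the vector field `Y` on `E^{4|8}`. -/
structure IsLift (X : VField 6 Odd6 N) (Y : VField 4 Odd4 N) : Prop where
  even : ∀ k x, X (Sum.inl (Fin.castAdd 2 k)) x = liftOdd N (Y (Sum.inl k) (proj x))
  odd : ∀ m x, X (Sum.inr m) x = dictSign m • liftOdd N (Y (Sum.inr (dict m)) (proj x))

theorem sum_coord4 {E : Type*} [AddCommMonoid E] (F : Fin 4 ⊕ Odd4 → E) :
    ∑ k, F k = ∑ k, F (Sum.inl k) + ∑ m, F (Sum.inr (dict m)) := by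
  rw [Fintype.sum_sum_type]
  congr 1
  exact (Equiv.sum_comp dictEquiv fun l => F (Sum.inr l)).symm

theorem sum_coord6 {E : Type*} [AddCommMonoid E] (F : Fin 6 ⊕ Odd6 → E) :
    ∑ k, F k = ∑ k : Fin 4, F (Sum.inl (Fin.castAdd 2 k)) + ∑ k : Fin 2, F (Sum.inl (Fin.natAdd 4 k))
      + ∑ m, F (Sum.inr m) := by
  rw [Fintype.sum_sum_type]
  congr 1
  exact Fin.sum_univ_add (a := 4) (b := 2) fun k => F (Sum.inl k)

/-- Pull-backs are constant along the vertical directions, so those components of `X` drop out; in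
the odd directions the sign of the coefficient cancels that of the derivative. -/
theorem IsLift.act_lift {X : VField 6 Odd6 N} {Y : VField 4 Odd4 N} (hXY : IsLift X Y)
    {φ : SFun 4 Odd4 N} {x : Fin 6 → ℝ} (h : DifferentiableAt ℝ φ (proj x)) :
    X.act (fun y => liftOdd N (φ (proj y))) x = liftOdd N (Y.act φ (proj x)) := by
  simp only [VField.act, sum_coord4, sum_coord6, map_add, map_sum, map_mul, pder_lift_castAdd h,
    pder_lift_natAdd h, hXY.even, mul_zero, Finset.sum_const_zero, add_zero, pder_lift_inr,
    hXY.odd, smul_mul_smul_comm, dictSign_mul_self, one_smul]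

theorem IsLift.actM_lift {X : VField 6 Odd6 N} {Y : VField 4 Odd4 N} (hXY : IsLift X Y)
    {M : MFun 4 Odd4 N} {x : Fin 6 → ℝ}
    (h : ∀ r s, DifferentiableAt ℝ (fun y => M y r s) (proj x)) :
    X.actM (liftM M) x = (Y.actM M (proj x)).map (liftOdd N) := by
  refine Matrix.ext fun r s => ?_
  simp only [VField.actM, Matrix.of_apply, Matrix.map_apply]
  rw [← hXY.act_lift (h r s)]
  rfl

end

section

/-! ### The left-invariant odd vector fields -/

variable {N : ℕ}

theorem D6_const (m : Odd6) (k : Fin 6 ⊕ Odd6) (x y : Fin 6 → ℝ) : D6 N m k x = D6 N m k y := by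
  cases k <;> rfl

theorem D4_const (l : Odd4) (k : Fin 4 ⊕ Odd4) (x y : Fin 4 → ℝ) : D4 N l k x = D4 N l k y := by
  rcases l with l | l <;> cases k <;> rfl

theorem D4_inr (l l' : Odd4) (x : Fin 4 → ℝ) :
    D4 N l (Sum.inr l') x = if l' = l then 1 else 0 := by
  rcases l with l | l <;> rfl

theorem liftOdd_gen (l : Odd4) :
    liftOdd N (gen (Sum.inl l)) = dictSign (undict l) • gen (Sum.inl (undict l)) := by
  have := liftOdd_gen_inl (N := N) (undict l)
  rwa [dict_undict] at this

/-- The left-invariant odd vector fields on `E^{4|8}`, indexed as those on `E^{6|8}`. -/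
def D4s (N : ℕ) (m : Odd6) : VField 4 Odd4 N := dictSign m • D4 N (dict m)

theorem D4s_apply (m : Odd6) (k : Fin 4 ⊕ Odd4) (x : Fin 4 → ℝ) :
    D4s N m k x = dictSign m • D4 N (dict m) k x := rfl

/-- This is where the signs and the index flip of the dictionary are needed. Only the `∂_{12}` and
`∂_{34}` terms of `D_{ai}` are lost under projection. -/
theorem isLift_D6 (m : Odd6) : IsLift (D6 N m) (D4s N m) where
  even k x := by
    obtain ⟨a, i⟩ := m
    fin_cases a <;> fin_cases i <;> fin_cases k <;>
      simp [D6, D4s, D4, dict, dictSign, dy6, dy4, eps, Fin.sum_univ_succ, liftOdd_gen, undict]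
  odd m' x := by
    rw [D4s_apply, D4_inr]
    by_cases h : m' = m
    · subst h
      simp [D6, smul_smul, dictSign_mul_self]
    · simp [D6, h, dict_injective.eq_iff]

theorem differentiableAt_D4 (l : Odd4) (k : Fin 4 ⊕ Odd4) (x : Fin 4 → ℝ) :
    DifferentiableAt ℝ (D4 N l k) x := by
  have : D4 N l k = fun _ => D4 N l k 0 := funext fun y => D4_const l k y 0
  rw [this]
  exact differentiableAt_const _

theorem differentiableAt_D6 (m : Odd6) (k : Fin 6 ⊕ Odd6) (x : Fin 6 → ℝ) :
    DifferentiableAt ℝ (D6 N m k) x := by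
  have : D6 N m k = fun _ => D6 N m k 0 := funext fun y => D6_const m k y 0
  rw [this]
  exact differentiableAt_const _

theorem differentiableAt_D4s (m : Odd6) (k : Fin 4 ⊕ Odd4) (x : Fin 4 → ℝ) :
    DifferentiableAt ℝ (D4s N m k) x :=
  (differentiableAt_D4 (dict m) k x).const_smul (dictSign m)

theorem D6_mem_parityPart (m : Odd6) (k : Fin 6 ⊕ Odd6) (x : Fin 6 → ℝ) :
    D6 N m k x ∈ parityPart (Odd6 ⊕ Fin N) (1 + coordParity k) := by
  rcases k with k | k
  · rw [show (1 : ZMod 2) + coordParity (Sum.inl k : Fin 6 ⊕ Odd6) = 1 from add_zero _]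
    exact Submodule.neg_mem _ (Submodule.sum_mem _ fun b _ => Submodule.sum_mem _ fun j _ =>
      Submodule.smul_mem _ _ (gen_mem_parityPart _))
  · rw [show (1 : ZMod 2) + coordParity (Sum.inr k : Fin 6 ⊕ Odd6) = 0 from
      CharTwo.add_self_eq_zero _]
    simp only [D6]
    split_ifs
    · exact SetLike.GradedOne.one_mem
    · exact Submodule.zero_mem _

theorem eps_antisymm (i j : Fin 2) : eps j i = -eps i j := by
  fin_cases i <;> fin_cases j <;> simp [eps]

theorem dy6_antisymm (a b : Fin 4) : dy6 b a = -dy6 a b := by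
  fin_cases a <;> fin_cases b <;> simp [dy6]

/-- The coefficient is linear in the odd coordinates and independent of the even ones, so only the
`∂_{θ^m}` part of `D_m` acts on it. -/
theorem D6_act_inl (m p : Odd6) (k : Fin 6) (x : Fin 6 → ℝ) :
    (D6 N m).act (D6 N p (Sum.inl k)) x = -(eps p.2 m.2 * dy6 p.1 m.1 k) • 1 := by
  have h0 : ∀ l : Fin 6, pder (Sum.inl l) (D6 N p (Sum.inl k)) x = 0 := fun l => pder_const _ _ _
  have h1 : pder (Sum.inr m) (D6 N p (Sum.inl k)) x
      = -(eps p.2 m.2 * dy6 p.1 m.1 k) • 1 := by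
    simp only [pder, D6, map_neg, map_sum, map_smul, contractLeft_gen, Sum.inl.injEq, neg_smul]
    congr 1
    rw [← Fintype.sum_prod_type' fun b j => (eps p.2 j * dy6 p.1 b k) •
      if m = (b, j) then (1 : Gr (Odd6 ⊕ Fin N)) else 0]
    simp
  simp only [VField.act, Fintype.sum_sum_type, h0, mul_zero, Finset.sum_const_zero, zero_add]
  rw [Finset.sum_eq_single m (fun l _ hl => by simp [D6, hl]) (by simp), h1]
  simp [D6]

theorem act_algebraMap {n : ℕ} {J : Type} [Fintype J] (X : VField n J N) (c : ℂ)
    (x : Fin n → ℝ) : X.act (fun _ => algebraMap ℂ _ c) x = 0 := by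
  refine Finset.sum_eq_zero fun k _ => ?_
  rcases k with k | k
  · rw [pder_const, mul_zero]
  · rw [pder, CliffordAlgebra.contractLeft_algebraMap, mul_zero]

/-- The two halves of the bracket agree because a product of two antisymmetric symbols is symmetric
under exchanging `m` and `p`; this gives the factor 2. -/
theorem oddBracket_D6_inl (m p : Odd6) (k : Fin 6) (x : Fin 6 → ℝ) :
    oddBracket (D6 N m) (D6 N p) (Sum.inl k) x = (-2 * eps m.2 p.2 * dy6 m.1 p.1 k) • 1 := by
  rw [oddBracket, D6_act_inl, D6_act_inl, ← add_smul, eps_antisymm m.2 p.2, dy6_antisymm m.1 p.1,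
    Pi.neg_apply]
  congr 1
  ring

theorem oddBracket_D6_inr (m p l : Odd6) (x : Fin 6 → ℝ) :
    oddBracket (D6 N m) (D6 N p) (Sum.inr l) x = 0 := by
  have h : ∀ p, D6 N p (Sum.inr l) = fun _ => algebraMap ℂ _ (if l = p then 1 else 0) := by
    intro p; funext x; simp only [D6]; split_ifs <;> simp
  rw [oddBracket, h, h, act_algebraMap, act_algebraMap, add_zero]

theorem oddBracket_D4s_inr (m p : Odd6) (l : Odd4) (x : Fin 4 → ℝ) :
    oddBracket (D4s N m) (D4s N p) (Sum.inr l) x = 0 := by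
  have h : ∀ p, D4s N p (Sum.inr l)
      = fun _ => algebraMap ℂ _ (if l = dict p then dictSign p else 0) := by
    intro p; funext x; rw [D4s_apply, D4_inr]; split_ifs <;> simp [Algebra.algebraMap_eq_smul_one]
  rw [oddBracket, h, h, act_algebraMap, act_algebraMap, add_zero]

/-- Brackets of projectable fields project to the brackets of their projections. -/
theorem oddBracket_D6_castAdd (m p : Odd6) (k : Fin 4) (x : Fin 6 → ℝ) :
    oddBracket (D6 N m) (D6 N p) (Sum.inl (Fin.castAdd 2 k)) x
      = liftOdd N (oddBracket (D4s N m) (D4s N p) (Sum.inl k) (proj x)) := by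
  have h : ∀ p, D6 N p (Sum.inl (Fin.castAdd 2 k))
      = fun y => liftOdd N (D4s N p (Sum.inl k) (proj y)) :=
    fun p => funext fun y => (isLift_D6 p).even k y
  rw [oddBracket, h, h, (isLift_D6 m).act_lift (differentiableAt_D4s _ _ _),
    (isLift_D6 p).act_lift (differentiableAt_D4s _ _ _), oddBracket, map_add]

/-! ### The curvature of a reduction -/

variable {I : Type*} {P : Bundle 4 Odd4 N I}

/-- The covariant derivatives of `A` along the fields of `E^{6|8}` that correspond to those of
`E^{4|8}` restrict to the covariant derivatives of `B`. -/
structure Reduces (A : Connection P.pullback) (B : Connection P) : Prop where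
  even : ∀ α (k : Fin 4), resM (A.pot α (Sum.inl (Fin.castAdd 2 k))) = B.pot α (Sum.inl k)
  odd : ∀ α m, resM (A.eval α (D6 N m)) = B.eval α (D4s N m)

theorem eval_translate {A : Connection P.pullback} (hA : IsTranslationInvariant A) (α : I)
    {X : VField 6 Odd6 N} (hX : ∀ k x y, X k x = X k y) :
    liftM (resM (A.eval α X)) = A.eval α X := by
  refine liftM_resM fun x v hv => ?_
  simp only [Connection.eval]
  exact Finset.sum_congr rfl fun k _ => by rw [hA α k x v hv, hX k (x + v) x]

/-- Derivatives and products of pull-backs are pull-backs. The bracket alone has components that do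
not project, and the sum collects them. -/
theorem oddCurv_eq {A : Connection P.pullback} {B : Connection P}
    (hA : IsTranslationInvariant A) (h : Reduces A B) (α : I) (m p : Odd6) {x : Fin 6 → ℝ}
    (hx : proj x ∈ P.U α) :
    A.oddCurv α (D6 N m) (D6 N p) x
      = (B.oddCurv α (D4s N m) (D4s N p) (proj x)).map (liftOdd N)
        - ∑ k : Fin 2, oddBracket (D6 N m) (D6 N p) (Sum.inl (Fin.natAdd 4 k)) x
            • A.pot α (Sum.inl (Fin.natAdd 4 k)) x := by
  have hE : ∀ q, A.eval α (D6 N q) = liftM (B.eval α (D4s N q)) := fun q => by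
    rw [← h.odd, eval_translate hA α (D6_const q)]
  have hK : ∀ k : Fin 4, A.pot α (Sum.inl (Fin.castAdd 2 k)) x
      = (B.pot α (Sum.inl k) (proj x)).map (liftOdd N) := fun k => by
    rw [← liftM_resM (hA α (Sum.inl (Fin.castAdd 2 k))), h.even]; rfl
  have hb : A.eval α (oddBracket (D6 N m) (D6 N p)) x
      = (B.eval α (oddBracket (D4s N m) (D4s N p)) (proj x)).map (liftOdd N)
        + ∑ k : Fin 2, oddBracket (D6 N m) (D6 N p) (Sum.inl (Fin.natAdd 4 k)) x
            • A.pot α (Sum.inl (Fin.natAdd 4 k)) x := by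
    simp only [Connection.eval]
    rw [sum_coord6, sum_coord4]
    simp only [oddBracket_D6_inr, oddBracket_D4s_inr, zero_smul, Finset.sum_const_zero, add_zero,
      oddBracket_D6_castAdd, hK, map_liftOdd_sum, map_liftOdd_smul]
  have hd : ∀ q q', (D6 N q).actM (liftM (B.eval α (D4s N q'))) x
      = ((D4s N q).actM (B.eval α (D4s N q')) (proj x)).map (liftOdd N) := fun q q' =>
    (isLift_D6 q).actM_lift fun r s =>
      B.differentiableAt_eval α hx (fun k => differentiableAt_D4s _ _ _) r s
  simp only [Connection.oddCurv, hb, hE, hd]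
  simp only [liftM]
  rw [Matrix.map_sub _ (map_sub _), Matrix.map_add _ (map_add _), Matrix.map_add _ (map_add _),
    Matrix.map_add _ (map_add _), Matrix.map_mul, Matrix.map_mul]
  abel

end

section

variable {N : ℕ} {I : Type*}

/-! ### Frame fields with constant coefficients, and extensionality -/

section General

/-- Writes a multiple of one frame field as a combination with even coefficients, to which
tensoriality applies. -/
theorem comb_indicator {n : ℕ} {J K : Type} [Fintype K] [DecidableEq K] (D : K → VField n J N) (i : K)
    (c : ℂ) : comb D (fun l _ => if l = i then algebraMap ℂ _ c else 0) = c • D i := by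
  funext k x
  simp [comb, ite_mul, Algebra.algebraMap_eq_smul_one]

variable {n : ℕ} {J : Type} [Fintype J] {P : Bundle n J N I}

theorem Bundle.differentiableAt_g (P : Bundle n J N I) (α β : I) {x : Fin n → ℝ}
    (hx : x ∈ P.U α ∩ P.U β) (r s : Fin 2) : DifferentiableAt ℝ (fun y => P.g α β y r s) x :=
  ((P.smooth α β r s).contDiffAt (((P.isOpen α).inter (P.isOpen β)).mem_nhds hx)).differentiableAt
    (by simp)

theorem AdSection.ext_val {S T : AdSection P} (h : S.val = T.val) : S = T := by
  cases S; cases T; cases h; rfl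

theorem isEvenOn_const (U : Set (Fin n → ℝ)) (p : Prop) [Decidable p] (c : ℂ) :
    IsEvenOn (N := N) (J := J) U (fun _ => if p then algebraMap ℂ _ c else 0) where
  smooth := contDiffOn_const
  even x _ := by
    split_ifs
    · exact SetLike.algebraMap_mem_graded _ c
    · exact Submodule.zero_mem _

theorem IsEvenOn.differentiableAt {U : Set (Fin n → ℝ)} (hU : IsOpen U) {f : SFun n J N}
    (hf : IsEvenOn U f) {x : Fin n → ℝ} (hx : x ∈ U) : DifferentiableAt ℝ f x :=
  (hf.smooth.contDiffAt (hU.mem_nhds hx)).differentiableAt (by simp)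

variable [DecidableEq J]

theorem Connection.ext_pot {A B : Connection P} (h : ∀ α k, A.pot α k = B.pot α k) : A = B := by
  have : A.pot = B.pot := funext fun α => funext fun k => h α k
  cases A; cases B; cases this; rfl

theorem Connection.eval_coordField (A : Connection P) (α : I) (k : Fin n ⊕ J) :
    A.eval α (coordField k) = A.pot α k := by
  funext x
  simp [Connection.eval, coordField]

theorem Connection.eval_smul (A : Connection P) (α : I) (c : ℂ) (X : VField n J N) :
    A.eval α (c • X) = c • A.eval α X := by
  funext x
  simp [Connection.eval, Finset.smul_sum]

theorem Connection.eval_constField (A : Connection P) (α : I) (c : Fin n → ℂ) :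
    A.eval α (constField c) = ∑ k, c k • A.pot α (Sum.inl k) := by
  funext x
  simp [Connection.eval, constField, Algebra.algebraMap_eq_smul_one]

theorem Connection.oddCurv_smul {K : Type} [Fintype K] [DecidableEq K] (A : Connection P) (α : I)
    {D : K → VField n J N} {x : Fin n → ℝ} (hx : x ∈ P.U α)
    (hD : ∀ j k, DifferentiableAt ℝ (D j k) x) (i j : K) (c d : ℂ) :
    A.oddCurv α (c • D i) (d • D j) x = (c * d) • A.oddCurv α (D i) (D j) x := by
  have hc : ∀ (i : K) (c : ℂ) l, IsEvenOn (N := N) (J := J) (P.U α)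
      (fun _ => if l = i then algebraMap ℂ _ c else 0) :=
    fun i c l => isEvenOn_const _ _ _
  rw [← comb_indicator D i c, ← comb_indicator D j d,
    A.oddCurv_comb α hx hD (fun l => (hc i c l).differentiableAt (P.isOpen α) hx)
      (fun l => (hc j d l).differentiableAt (P.isOpen α) hx) (fun l => (hc i c l).even x hx)
      (fun l => (hc j d l).even x hx)]
  simp only [ite_mul, mul_ite, zero_mul, mul_zero, ite_smul, zero_smul, Finset.sum_ite_eq',
    Finset.mem_univ, if_true]
  rw [← map_mul, algebraMap_smul]

end General

/-! ### Reduction of connections -/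

variable {P : Bundle 4 Odd4 N I}

/-- The lifts to `E^{6|8}` of the coordinate fields of `E^{4|8}` along which the covariant
derivatives are reduced. -/
def hLift (N : ℕ) : Fin 4 ⊕ Odd4 → VField 6 Odd6 N
  | Sum.inl k => coordField (Sum.inl (Fin.castAdd 2 k))
  | Sum.inr l => fun k x => match k with
    | Sum.inl k => Fin.addCases (m := 4) (n := 2) (motive := fun _ => Gr (Odd6 ⊕ Fin N))
        (fun _ => 0)
        (fun k => dictSign (undict l) • D6 N (undict l) (Sum.inl (Fin.natAdd 4 k)) x) k
    | Sum.inr m => if m = undict l then dictSign m • 1 else 0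

theorem hLift_inr_castAdd (l : Odd4) (k : Fin 4) (x : Fin 6 → ℝ) :
    hLift N (Sum.inr l) (Sum.inl (Fin.castAdd 2 k)) x = 0 := by
  fin_cases k <;> rfl

theorem hLift_inr_natAdd (l : Odd4) (k : Fin 2) (x : Fin 6 → ℝ) :
    hLift N (Sum.inr l) (Sum.inl (Fin.natAdd 4 k)) x
      = dictSign (undict l) • D6 N (undict l) (Sum.inl (Fin.natAdd 4 k)) x := by
  fin_cases k <;> rfl

theorem hLift_inr_inr (l : Odd4) (m : Odd6) (x : Fin 6 → ℝ) :
    hLift N (Sum.inr l) (Sum.inr m) x = if m = undict l then dictSign m • 1 else 0 := rfl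

/-- For an odd direction the lift is, up to sign, `D_{ai}` with its components along `ℝ⁴` removed.
The vertical components are kept so that the reduction sends `A(D_{ai})` to the value of `B` on the
corresponding field; they are invisible to the projection. -/
theorem isLift_hLift (k : Fin 4 ⊕ Odd4) : IsLift (hLift N k) (coordField k) := by
  rcases k with k | l
  · refine ⟨fun j x => ?_, fun m x => ?_⟩
    · by_cases h : j = k
      · simp [hLift, coordField, h]
      · have h' : (Fin.castAdd 2 j : Fin 6) ≠ Fin.castAdd 2 k :=
          fun e => h (Fin.castAdd_injective 4 2 e)
        simpa [hLift, coordField, h] using h'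
    · simp [hLift, coordField]
  · refine ⟨fun j x => ?_, fun m x => ?_⟩
    · rw [hLift_inr_castAdd]; simp [coordField]
    · rw [hLift_inr_inr]
      by_cases h : m = undict l
      · simp [coordField, h, dict_undict]
      · have h' : dict m ≠ l := fun e => h (by rw [← e, undict_dict])
        simp [coordField, h, h']

theorem hLift_const (k : Fin 4 ⊕ Odd4) (j : Fin 6 ⊕ Odd6) (x y : Fin 6 → ℝ) :
    hLift N k j x = hLift N k j y := by
  rcases k with k | l
  · rfl
  · rcases j with j | m
    · induction j using Fin.addCases (m := 4) (n := 2) with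
      | left j => rw [hLift_inr_castAdd, hLift_inr_castAdd]
      | right j => rw [hLift_inr_natAdd, hLift_inr_natAdd, D6_const _ _ x y]
    · rfl

theorem hLift_mem_parityPart (k : Fin 4 ⊕ Odd4) (j : Fin 6 ⊕ Odd6) (x : Fin 6 → ℝ) :
    hLift N k j x ∈ parityPart (Odd6 ⊕ Fin N) (coordParity k + coordParity j) := by
  rcases k with k | l
  · by_cases h : j = Sum.inl (Fin.castAdd 2 k)
    · subst h
      simpa [hLift, coordField, coordParity] using SetLike.GradedOne.one_mem
    · simp [hLift, coordField, h]
  · rcases j with j | m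
    · induction j using Fin.addCases (m := 4) (n := 2) with
      | left j => rw [hLift_inr_castAdd]; exact Submodule.zero_mem _
      | right j =>
        rw [hLift_inr_natAdd]
        exact Submodule.smul_mem _ _ (D6_mem_parityPart _ (Sum.inl (Fin.natAdd 4 j)) x)
    · rw [hLift_inr_inr, show (coordParity (Sum.inr l : Fin 4 ⊕ Odd4)
        + coordParity (Sum.inr m : Fin 6 ⊕ Odd6)) = 0 from CharTwo.add_self_eq_zero _]
      split_ifs
      · exact Submodule.smul_mem _ _ SetLike.GradedOne.one_mem
      · exact Submodule.zero_mem _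

theorem map_resOdd_liftM (M : MFun 4 Odd4 N) (x : Fin 4 → ℝ) :
    (liftM M (embed x)).map (resOdd N) = M x := congrFun (resM_liftM M) x

theorem map_resOdd_liftOdd (M : Matrix (Fin 2) (Fin 2) (Gr (Odd4 ⊕ Fin N))) :
    (M.map (liftOdd N)).map (resOdd N) = M := by
  ext r s
  simp [resOdd_liftOdd]

/-- The inhomogeneous term differentiates a pulled-back transition function, so `X` enters it only
through its projection `Y`. The case of `Y` a coordinate field makes the reduction a connection; the
case `Y = 0` makes the scalars sections of the adjoint bundle. -/
theorem resM_eval_glue (A : Connection P.pullback) (α β : I) {X : VField 6 Odd6 N}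
    {Y : VField 4 Odd4 N} (hXY : IsLift X Y) {x : Fin 4 → ℝ} (hx : x ∈ P.U α ∩ P.U β) :
    resM (A.eval β X) x = P.g β α x * resM (A.eval α X) x * P.g α β x
      + P.g β α x * Y.actM (P.g α β) x := by
  have hx' : embed x ∈ P.pullback.U α ∩ P.pullback.U β := by
    change proj (embed x) ∈ P.U α ∩ P.U β
    rwa [proj_embed]
  have hg : ∀ α β, P.pullback.g α β = liftM (P.g α β) := fun _ _ => rfl
  simp only [resM]
  rw [A.eval_glue α β X hx', Matrix.map_add _ (map_add _), Matrix.map_mul, Matrix.map_mul,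
    Matrix.map_mul, hg, hg, map_resOdd_liftM, map_resOdd_liftM,
    hXY.actM_lift (fun r s => P.differentiableAt_g α β (by rwa [proj_embed]) r s),
    map_resOdd_liftOdd, proj_embed]

/-- The dimensional reduction of a connection. -/
def reduction (A : Connection P.pullback) : Connection P where
  pot α k := resM (A.eval α (hLift N k))
  lieValued α k := (A.lieValued_eval α (fun j => hLift N k j 0) (fun j _ => hLift_const k j _ 0)
    (fun j => hLift_mem_parityPart k j 0)).res
  glue α β k _ hx := resM_eval_glue A α β (isLift_hLift k) hx

theorem Connection.eval_D6 (A : Connection P.pullback) (α : I) (m : Odd6) (x : Fin 6 → ℝ) :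
    A.eval α (D6 N m) x
      = ∑ k : Fin 4, D6 N m (Sum.inl (Fin.castAdd 2 k)) x • A.pot α (Sum.inl (Fin.castAdd 2 k)) x
        + ∑ k : Fin 2, D6 N m (Sum.inl (Fin.natAdd 4 k)) x • A.pot α (Sum.inl (Fin.natAdd 4 k)) x
        + A.pot α (Sum.inr m) x := by
  rw [Connection.eval, sum_coord6]
  congr 1
  simp [D6]

theorem Connection.eval_D4s (B : Connection P) (α : I) (m : Odd6) (x : Fin 4 → ℝ) :
    B.eval α (D4s N m) x
      = ∑ k : Fin 4, D4s N m (Sum.inl k) x • B.pot α (Sum.inl k) x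
        + dictSign m • B.pot α (Sum.inr (dict m)) x := by
  rw [Connection.eval, sum_coord4]
  congr 1
  simp [D4s_apply, D4_inr, dict_injective.eq_iff]

theorem D4s_eq_resOdd (m : Odd6) (k : Fin 4) (x : Fin 4 → ℝ) :
    D4s N m (Sum.inl k) x = resOdd N (D6 N m (Sum.inl (Fin.castAdd 2 k)) (embed x)) := by
  rw [(isLift_D6 m).even, resOdd_liftOdd, proj_embed]

/-- `D_{ai}` is its part along `ℝ⁴` plus, up to sign, the chosen lift of an odd coordinate field,
and `A` is linear in the field. -/
theorem reduces_reduction (A : Connection P.pullback) : Reduces A (reduction A) where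
  even α k := by
    rw [← A.eval_coordField]
    rfl
  odd α m := by
    funext x
    have e : A.eval α (hLift N (Sum.inr (dict m))) (embed x) = dictSign m •
        (∑ k : Fin 2, D6 N m (Sum.inl (Fin.natAdd 4 k)) (embed x)
            • A.pot α (Sum.inl (Fin.natAdd 4 k)) (embed x)
          + A.pot α (Sum.inr m) (embed x)) := by
      rw [Connection.eval, sum_coord6]
      simp only [hLift_inr_castAdd, hLift_inr_natAdd, hLift_inr_inr, undict_dict, zero_smul,
        Finset.sum_const_zero, zero_add, smul_add, Finset.smul_sum, smul_assoc]
      congr 1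
      simp
    have h1 : (reduction A).pot α (Sum.inr (dict m)) x
        = (A.eval α (hLift N (Sum.inr (dict m))) (embed x)).map (resOdd N) := rfl
    have h2 : ∀ k : Fin 4, (reduction A).pot α (Sum.inl k) x
        = (A.pot α (Sum.inl (Fin.castAdd 2 k)) (embed x)).map (resOdd N) := fun k => by
      rw [← A.eval_coordField]; rfl
    have h3 : ∀ (c : ℂ) (M : Matrix (Fin 2) (Fin 2) (Gr (Odd6 ⊕ Fin N))),
        (c • M).map (resOdd N) = c • M.map (resOdd N) := fun c M => by ext r s; simp
    rw [Connection.eval_D4s, h1, e, h3, smul_smul, dictSign_mul_self, one_smul]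
    simp only [resM, h2, D4s_eq_resOdd, ← map_resOdd_smul, ← map_resOdd_sum]
    rw [← Matrix.map_add _ (map_add _), A.eval_D6, add_assoc]

theorem Reduces.isReduction {A : Connection P.pullback} {B : Connection P} (h : Reduces A B) :
    IsReduction A B := by
  have key : ∀ (α : I) (c : Fin 6 → ℂ) (c' : Fin 4 → ℂ), (∀ k : Fin 4, c (Fin.castAdd 2 k) = c' k) →
      (∀ k : Fin 2, c (Fin.natAdd 4 k) = 0) →
      resM (A.eval α (constField c)) = B.eval α (constField c') := by
    intro α c c' h1 h2
    rw [A.eval_constField, B.eval_constField]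
    have := Fin.sum_univ_add (a := 4) (b := 2) fun k : Fin 6 => c k • A.pot α (Sum.inl k)
    rw [this]
    simp only [h1, h2, zero_smul, Finset.sum_const_zero, add_zero, ← h.even]
    funext x
    ext r s
    simp [resM, Matrix.sum_apply]
  refine ⟨fun α m => ?_, fun α => key α _ _ ?_ ?_, fun α => key α _ _ ?_ ?_, fun α => key α _ _ ?_ ?_,
    fun α => key α _ _ ?_ ?_⟩
  · rw [h.odd, D4s, B.eval_smul]
  all_goals intro k; fin_cases k <;> simp [dy6, dy4]

/-- The system is triangular: the frame field is a sign times an odd coordinate field plus even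
fields, on which the two connections already agree. -/
theorem Reduces.unique {A : Connection P.pullback} {B B' : Connection P} (h : Reduces A B)
    (h' : Reduces A B') : B = B' := by
  have h1 : ∀ α k, B.pot α (Sum.inl k) = B'.pot α (Sum.inl k) := fun α k => by
    rw [← h.even, h'.even]
  refine Connection.ext_pot fun α k => ?_
  rcases k with k | l
  · exact h1 α k
  · obtain ⟨m, rfl⟩ := dictEquiv.surjective l
    change B.pot α (Sum.inr (dict m)) = B'.pot α (Sum.inr (dict m))
    funext x
    have e : B.eval α (D4s N m) x = B'.eval α (D4s N m) x := by rw [← h.odd, h'.odd]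
    rw [B.eval_D4s, B'.eval_D4s] at e
    simp only [h1] at e
    have e2 := congrArg (fun M => dictSign m • M) (add_left_cancel e)
    simpa only [smul_smul, dictSign_mul_self, one_smul] using e2

end

section

variable {N : ℕ} {I : Type*} {P : Bundle 4 Odd4 N I}

/-! ### The scalars -/

/-- The covariant derivatives along `x₄` and `x₅` in terms of the two scalars. -/
def scalarPot (S T : MFun 4 Odd4 N) : Fin 2 → MFun 4 Odd4 N :=
  ![(1 / 2 : ℂ) • T + (-1 / 2 : ℂ) • S, (Complex.I / 2) • T + (Complex.I / 2) • S]

theorem resM_eval_dy6 (A : Connection P.pullback) (α : I) (a b : Fin 4)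
    (h : ∀ k : Fin 4, dy6 a b (Fin.castAdd 2 k) = 0) :
    resM (A.eval α (constField (dy6 a b)))
      = dy6 a b 4 • resM (A.pot α (Sum.inl 4)) + dy6 a b 5 • resM (A.pot α (Sum.inl 5)) := by
  rw [A.eval_constField]
  have := Fin.sum_univ_add (a := 4) (b := 2) fun k : Fin 6 => dy6 a b k • A.pot α (Sum.inl k)
  rw [this]
  simp only [h, zero_smul, Finset.sum_const_zero, zero_add, Fin.sum_univ_two]
  funext x
  ext r s
  simp only [resM, Pi.add_apply, Pi.smul_apply, Matrix.map_apply, Matrix.add_apply,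
    Matrix.smul_apply, map_add, map_smul]
  rfl

theorem two_smul_resM_eval_dy6_23 (A : Connection P.pullback) (α : I) :
    (2 : ℂ) • resM (A.eval α (constField (dy6 2 3)))
      = (-1 : ℂ) • resM (A.pot α (Sum.inl 4)) + (-Complex.I) • resM (A.pot α (Sum.inl 5)) := by
  rw [resM_eval_dy6 A α 2 3 (by intro k; fin_cases k <;> simp [dy6]), smul_add, smul_smul,
    smul_smul]
  congr 2 <;> simp [dy6] <;> ring

theorem two_smul_resM_eval_dy6_01 (A : Connection P.pullback) (α : I) :
    (2 : ℂ) • resM (A.eval α (constField (dy6 0 1)))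
      = (1 : ℂ) • resM (A.pot α (Sum.inl 4)) + (-Complex.I) • resM (A.pot α (Sum.inl 5)) := by
  rw [resM_eval_dy6 A α 0 1 (by intro k; fin_cases k <;> simp [dy6]), smul_add, smul_smul,
    smul_smul]
  congr 2 <;> simp [dy6]
  ring

/-- Inverts the system given by `2∂_{34} = -∂_4 - i∂_5` and `2∂_{12} = ∂_4 - i∂_5`. -/
theorem scalarPot_eq_iff {E F : MFun 4 Odd4 N} {S T : MFun 4 Odd4 N} :
    (S = (-1 : ℂ) • E + (-Complex.I) • F ∧ T = (1 : ℂ) • E + (-Complex.I) • F)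
      ↔ E = scalarPot S T 0 ∧ F = scalarPot S T 1 := by
  have hI : Complex.I * Complex.I = -1 := Complex.I_mul_I
  constructor
  · rintro ⟨rfl, rfl⟩
    constructor
    · simp only [scalarPot, Matrix.cons_val_zero]
      module
    · simp only [scalarPot, Matrix.cons_val_one, Matrix.cons_val_zero, smul_add, smul_smul,
        mul_neg, div_mul_eq_mul_div, hI]
      module
  · rintro ⟨rfl, rfl⟩
    simp only [scalarPot, Matrix.cons_val_one, Matrix.cons_val_zero, smul_add, smul_smul,
      neg_mul, mul_div_assoc', hI]
    constructor <;> module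

/-- `S`, `T` are the scalars of the translation-invariant connection `A`. -/
def HasScalars (A : Connection P.pullback) (S T : AdSection P) : Prop :=
  ∀ α (k : Fin 2), resM (A.pot α (Sum.inl (Fin.natAdd 4 k))) = scalarPot (S.val α) (T.val α) k

theorem hasScalars_iff {A : Connection P.pullback} {S T : AdSection P} :
    HasScalars A S T ↔
      (∀ α, S.val α = (2 : ℂ) • resM (A.eval α (constField (dy6 2 3)))) ∧
      (∀ α, T.val α = (2 : ℂ) • resM (A.eval α (constField (dy6 0 1)))) := by
  rw [← forall_and]
  refine forall_congr' fun α => ?_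
  rw [two_smul_resM_eval_dy6_23, two_smul_resM_eval_dy6_01, scalarPot_eq_iff, Fin.forall_fin_two]
  rfl

theorem isLift_constField {c : Fin 6 → ℂ} (h : ∀ k : Fin 4, c (Fin.castAdd 2 k) = 0) :
    IsLift (constField c : VField 6 Odd6 N) (0 : VField 4 Odd4 N) where
  even k x := by simp [constField, h]
  odd m x := by simp [constField]

/-- The section of the adjoint bundle given by the covariant derivative along a constant field in
the directions of the fibres of `proj`. -/
def verticalSection (A : Connection P.pullback) (c : Fin 6 → ℂ)
    (h : ∀ k : Fin 4, c (Fin.castAdd 2 k) = 0) : AdSection P where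
  val α := (2 : ℂ) • resM (A.eval α (constField c))
  lieValued α := by
    refine ((A.lieValued_eval α (fun j => constField (N := N) (J := Odd6) c j 0) ?_ ?_).res).const_smul 2
    · rintro (j | j) x <;> rfl
    · rintro (j | j)
      · change algebraMap ℂ (Gr (Odd6 ⊕ Fin N)) (c j) ∈ parityPart (Odd6 ⊕ Fin N) 0
        exact SetLike.algebraMap_mem_graded _ (c j)
      · exact Submodule.zero_mem _
  glue α β x hx := by
    have e : VField.actM (0 : VField 4 Odd4 N) (P.g α β) x = 0 := by
      ext r s; simp [VField.actM, VField.act]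
    rw [Pi.smul_apply, resM_eval_glue A α β (isLift_constField h) hx, e, mul_zero, add_zero,
      Pi.smul_apply, Matrix.mul_smul, Matrix.smul_mul]

theorem exists_hasScalars (A : Connection P.pullback) : ∃ S T, HasScalars A S T :=
  ⟨verticalSection A (dy6 2 3) (by intro k; fin_cases k <;> simp [dy6]),
    verticalSection A (dy6 0 1) (by intro k; fin_cases k <;> simp [dy6]),
    hasScalars_iff.2 ⟨fun _ => rfl, fun _ => rfl⟩⟩

/-! ### The curvature conditions on frames -/

theorem isConstrained_iff {Q : Bundle 6 Odd6 N I} {A : Connection Q} :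
    IsConstrained A ↔ ∀ α m p, ∀ x ∈ Q.U α, A.oddCurv α (D6 N m) (D6 N p) x = 0 := by
  constructor
  · intro h α m p x hx
    have := h α (fun l _ => if l = m then algebraMap ℂ _ 1 else 0)
      (fun l _ => if l = p then algebraMap ℂ _ 1 else 0) (fun l => isEvenOn_const _ _ _)
      (fun l => isEvenOn_const _ _ _) x hx
    rwa [comb_indicator, comb_indicator, one_smul, one_smul] at this
  · intro h α f g hf hg x hx
    rw [A.oddCurv_comb α hx (fun j k => differentiableAt_D6 j k x)
      (fun j => (hf j).differentiableAt (Q.isOpen α) hx)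
      (fun j => (hg j).differentiableAt (Q.isOpen α) hx) (fun j => (hf j).even x hx)
      (fun j => (hg j).even x hx)]
    simp only [h α _ _ x hx, smul_zero, Finset.sum_const_zero]

/-- The coefficients of `Sbar` in the curvature of a semi-constrained connection. -/
def semiD : Odd4 → Odd4 → ℂ
  | Sum.inl (a, i), Sum.inl (b, j) => eps a b * eps i j
  | _, _ => 0

/-- The coefficients of `S` in the curvature of a semi-constrained connection. -/
def semiDbar : Odd4 → Odd4 → ℂ
  | Sum.inr (a, i), Sum.inr (b, j) => eps a b * eps i j
  | _, _ => 0

theorem sum_semiD {E : Type*} [AddCommMonoid E] [Module ℂ E] (F : Odd4 → Odd4 → E) :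
    ∑ a, ∑ i, ∑ b, ∑ j, (eps a b * eps i j) • F (Sum.inl (a, i)) (Sum.inl (b, j))
      = ∑ l, ∑ l', semiD l l' • F l l' := by
  simp [Fintype.sum_sum_type, Fintype.sum_prod_type, semiD]

theorem sum_semiDbar {E : Type*} [AddCommMonoid E] [Module ℂ E] (F : Odd4 → Odd4 → E) :
    ∑ a, ∑ i, ∑ b, ∑ j, (eps a b * eps i j) • F (Sum.inr (a, i)) (Sum.inr (b, j))
      = ∑ l, ∑ l', semiDbar l l' • F l l' := by
  simp [Fintype.sum_sum_type, Fintype.sum_prod_type, semiDbar]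

theorem smul_smul_comm_gr {J : Type} (z : Gr J) (c : ℂ) (M : Matrix (Fin 2) (Fin 2) (Gr J)) :
    z • c • M = c • z • M := by
  ext r s
  simp

theorem isSemiConstrainedWith_iff {B : Connection P} {S T : AdSection P} :
    IsSemiConstrainedWith B S T ↔ ∀ α l l', ∀ x ∈ P.U α, B.oddCurv α (D4 N l) (D4 N l') x
      = -(semiD l l' • T.val α x + semiDbar l l' • S.val α x) := by
  constructor
  · intro h α l l' x hx
    have := h α (fun m _ => if m = l then algebraMap ℂ _ 1 else 0)
      (fun m _ => if m = l' then algebraMap ℂ _ 1 else 0) (fun l => isEvenOn_const _ _ _)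
      (fun l => isEvenOn_const _ _ _) x hx
    rw [comb_indicator, comb_indicator, one_smul, one_smul,
      sum_semiD fun a b => ((if a = l then algebraMap ℂ (Gr (Odd4 ⊕ Fin N)) 1 else 0)
        * if b = l' then algebraMap ℂ (Gr (Odd4 ⊕ Fin N)) 1 else 0),
      sum_semiDbar fun a b => ((if a = l then algebraMap ℂ (Gr (Odd4 ⊕ Fin N)) 1 else 0)
        * if b = l' then algebraMap ℂ (Gr (Odd4 ⊕ Fin N)) 1 else 0)] at this
    simp only [map_one, ite_mul, one_mul, zero_mul, smul_ite, smul_zero, Finset.sum_ite_irrel,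
      Finset.sum_const_zero, Finset.sum_ite_eq', Finset.mem_univ, if_true] at this
    rw [this, neg_add, neg_smul, neg_smul, smul_assoc, smul_assoc, one_smul, one_smul]
  · intro h α f g hf hg x hx
    rw [B.oddCurv_comb α hx (fun j k => differentiableAt_D4 j k x)
      (fun j => (hf j).differentiableAt (P.isOpen α) hx)
      (fun j => (hg j).differentiableAt (P.isOpen α) hx) (fun j => (hf j).even x hx)
      (fun j => (hg j).even x hx), sum_semiD fun a b => f a x * g b x,
      sum_semiDbar fun a b => f a x * g b x]
    rw [neg_smul, neg_smul, ← neg_add, Finset.sum_smul, Finset.sum_smul, ← Finset.sum_add_distrib,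
      ← Finset.sum_neg_distrib]
    refine Finset.sum_congr rfl fun i _ => ?_
    rw [Finset.sum_smul, Finset.sum_smul, ← Finset.sum_add_distrib, ← Finset.sum_neg_distrib]
    refine Finset.sum_congr rfl fun j _ => ?_
    rw [h α _ _ x hx, smul_neg, smul_add, smul_smul_comm_gr, smul_smul_comm_gr, smul_assoc,
      smul_assoc]

/-- Each scalar is, up to sign, one component of the curvature. Outside the charts both candidates
vanish by convention. -/
theorem IsSemiConstrainedWith.unique {B : Connection P} {S T S' T' : AdSection P}
    (h : IsSemiConstrainedWith B S T) (h' : IsSemiConstrainedWith B S' T') : S = S' ∧ T = T' := by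
  rw [isSemiConstrainedWith_iff] at h h'
  constructor
  · refine AdSection.ext_val (funext fun α => funext fun x => ?_)
    by_cases hx : x ∈ P.U α
    · have e := (h α (Sum.inr (0, 0)) (Sum.inr (1, 1)) x hx).symm.trans (h' α _ _ x hx)
      simpa [semiD, semiDbar, eps] using e
    · rw [(S.lieValued α).zero_off x hx, (S'.lieValued α).zero_off x hx]
  · refine AdSection.ext_val (funext fun α => funext fun x => ?_)
    by_cases hx : x ∈ P.U α
    · have e := (h α (Sum.inl (0, 0)) (Sum.inl (1, 1)) x hx).symm.trans (h' α _ _ x hx)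
      simpa [semiD, semiDbar, eps] using e
    · rw [(T.lieValued α).zero_off x hx, (T'.lieValued α).zero_off x hx]

/-- The functional `c ↦ c₄ + i c₅` takes the value 1 on `∂_{12}` and 0 on `∂_{34}`, so it extracts
the `∂_{12}` part of `∂_{ab}`. In `semiDbar_dict` the functional `c ↦ -c₄ + i c₅` does the same for
`∂_{34}`. -/
theorem semiD_dict (m p : Odd6) : dictSign m * dictSign p * semiD (dict m) (dict p)
    = eps m.2 p.2 * (dy6 m.1 p.1 4 + Complex.I * dy6 m.1 p.1 5) := by
  have hI : Complex.I * (Complex.I / 2) = -1 / 2 := by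
    rw [← mul_div_assoc, Complex.I_mul_I]
  obtain ⟨a, i⟩ := m
  obtain ⟨b, j⟩ := p
  fin_cases a <;> fin_cases b <;> fin_cases i <;> fin_cases j <;>
    simp [dict, dictSign, semiD, eps, dy6, hI, neg_div] <;> norm_num

theorem semiDbar_dict (m p : Odd6) : dictSign m * dictSign p * semiDbar (dict m) (dict p)
    = eps m.2 p.2 * (-dy6 m.1 p.1 4 + Complex.I * dy6 m.1 p.1 5) := by
  have hI : Complex.I * (Complex.I / 2) = -1 / 2 := by
    rw [← mul_div_assoc, Complex.I_mul_I]
  obtain ⟨a, i⟩ := m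
  obtain ⟨b, j⟩ := p
  fin_cases a <;> fin_cases b <;> fin_cases i <;> fin_cases j <;>
    simp [dict, dictSign, semiDbar, eps, dy6, hI, neg_div] <;> norm_num

/-- On the frame the curvature of `A` is, up to sign, the pull-back of the defect in the
semi-constraint equation for `B`, and pull-back is injective. -/
theorem isConstrained_iff_isSemiConstrainedWith {A : Connection P.pullback} {B : Connection P}
    {S T : AdSection P} (hA : IsTranslationInvariant A) (h : Reduces A B) (hS : HasScalars A S T) :
    IsConstrained A ↔ IsSemiConstrainedWith B S T := by
  have key : ∀ α m p (x : Fin 6 → ℝ), proj x ∈ P.U α → A.oddCurv α (D6 N m) (D6 N p) x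
      = ((dictSign m * dictSign p) • (B.oddCurv α (D4 N (dict m)) (D4 N (dict p)) (proj x)
        + (semiD (dict m) (dict p) • T.val α (proj x)
          + semiDbar (dict m) (dict p) • S.val α (proj x)))).map (liftOdd N) := by
    intro α m p x hx
    have hv : ∀ k : Fin 2, A.pot α (Sum.inl (Fin.natAdd 4 k)) x
        = (scalarPot (S.val α) (T.val α) k (proj x)).map (liftOdd N) := fun k => by
      rw [← liftM_resM (hA α (Sum.inl (Fin.natAdd 4 k))), hS]; rfl
    have h1 : ∀ (c : ℂ) (M : Matrix (Fin 2) (Fin 2) (Gr (Odd4 ⊕ Fin N))),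
        (c • (1 : Gr (Odd6 ⊕ Fin N))) • M.map (liftOdd N) = (c • M).map (liftOdd N) := by
      intro c M; ext r s; simp
    rw [oddCurv_eq hA h α m p hx, D4s, D4s,
      B.oddCurv_smul α hx (fun j k => differentiableAt_D4 j k _), Fin.sum_univ_two]
    simp only [hv, oddBracket_D6_inl, h1]
    rw [← Matrix.map_add _ (map_add _), ← Matrix.map_sub _ (map_sub _)]
    congr 1
    -- The factor -2 of the bracket absorbs the halves in `scalarPot`; what is left is linear in `S`
    -- and `T`.
    simp only [smul_add, smul_smul, semiD_dict, semiDbar_dict, scalarPot, Matrix.cons_val_zero,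
      Matrix.cons_val_one, Pi.add_apply, Pi.smul_apply,
      show (Fin.natAdd 4 (0 : Fin 2) : Fin 6) = 4 from rfl,
      show (Fin.natAdd 4 (1 : Fin 2) : Fin 6) = 5 from rfl]
    module
  have hinj : ∀ M : Matrix (Fin 2) (Fin 2) (Gr (Odd4 ⊕ Fin N)), M.map (liftOdd N) = 0 ↔ M = 0 := by
    intro M
    constructor
    · intro e
      rw [← map_resOdd_liftOdd M, e, Matrix.map_zero _ (map_zero _)]
    · rintro rfl
      exact Matrix.map_zero _ (map_zero _)
  have hs : ∀ m p : Odd6, dictSign m * dictSign p ≠ 0 := fun m p => by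
    have h1 := dictSign_mul_self m
    have h2 := dictSign_mul_self p
    refine mul_ne_zero ?_ ?_ <;> intro e <;> simp [e] at h1 h2
  rw [isConstrained_iff, isSemiConstrainedWith_iff]
  constructor
  · intro hc α l l' x hx
    obtain ⟨m, rfl⟩ := dictEquiv.surjective l
    obtain ⟨p, rfl⟩ := dictEquiv.surjective l'
    have hx' : proj (embed x) ∈ P.U α := by rwa [proj_embed]
    have e := hc α m p (embed x) hx'
    rw [key α m p _ hx', hinj, smul_eq_zero_iff_right (hs m p), proj_embed] at e
    exact eq_neg_of_add_eq_zero_left e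
  · intro hc α m p x hx
    rw [key α m p x hx, hc α _ _ _ hx, neg_add_cancel, smul_zero, Matrix.map_zero _ (map_zero _)]

/-! ### The inverse of the reduction -/

/-- Invariance recovers each component from its restriction: `B` gives the directions of `ℝ⁴`, the
scalars give the vertical ones, and the values on `D_{ai}` then give the odd ones. -/
theorem connection_eq_of_reduces {A A' : Connection P.pullback} {B : Connection P}
    {S T : AdSection P} (hA : IsTranslationInvariant A) (hA' : IsTranslationInvariant A')
    (h : Reduces A B) (h' : Reduces A' B) (hS : HasScalars A S T) (hS' : HasScalars A' S T) :
    A = A' := by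
  have h1 : ∀ α (k : Fin 4), A.pot α (Sum.inl (Fin.castAdd 2 k))
      = A'.pot α (Sum.inl (Fin.castAdd 2 k)) := fun α k => by
    rw [← liftM_resM (hA α (Sum.inl (Fin.castAdd 2 k))),
      ← liftM_resM (hA' α (Sum.inl (Fin.castAdd 2 k))), h.even, h'.even]
  have h2 : ∀ α (k : Fin 2), A.pot α (Sum.inl (Fin.natAdd 4 k))
      = A'.pot α (Sum.inl (Fin.natAdd 4 k)) := fun α k => by
    rw [← liftM_resM (hA α (Sum.inl (Fin.natAdd 4 k))),
      ← liftM_resM (hA' α (Sum.inl (Fin.natAdd 4 k))), hS, hS']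
  refine Connection.ext_pot fun α k => ?_
  rcases k with k | m
  · exact Fin.addCases (m := 4) (n := 2)
      (motive := fun k : Fin 6 => A.pot α (Sum.inl k) = A'.pot α (Sum.inl k)) (h1 α) (h2 α) k
  · funext x
    have e : A.eval α (D6 N m) x = A'.eval α (D6 N m) x := by
      rw [← eval_translate hA α (D6_const m), ← eval_translate hA' α (D6_const m), h.odd, h'.odd]
    rw [A.eval_D6, A'.eval_D6] at e
    simp only [h1, h2] at e
    exact add_left_cancel e

theorem lieValued_scalarPot (S T : AdSection P) (α : I) (k : Fin 2) :
    IsLieValued (P.U α) 0 (scalarPot (S.val α) (T.val α) k) := by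
  fin_cases k <;>
    exact ((T.lieValued α).const_smul _).add ((S.lieValued α).const_smul _)

theorem scalarPot_glue (S T : AdSection P) (α β : I) (k : Fin 2) {x : Fin 4 → ℝ}
    (hx : x ∈ P.U α ∩ P.U β) :
    scalarPot (S.val β) (T.val β) k x
      = P.g β α x * scalarPot (S.val α) (T.val α) k x * P.g α β x := by
  fin_cases k <;>
    simp [scalarPot, S.glue α β x hx, T.glue α β x hx, Matrix.mul_add, Matrix.add_mul]

/-- The components of the pull-back of `B` with the scalars `S`, `T` added. -/
def liftPot (B : Connection P) (S T : AdSection P) (α : I) : Fin 6 ⊕ Odd6 → MFun 6 Odd6 N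
  | Sum.inl k => Fin.addCases (m := 4) (n := 2) (motive := fun _ => MFun 6 Odd6 N)
      (fun k => liftM (B.pot α (Sum.inl k)))
      (fun k => liftM (scalarPot (S.val α) (T.val α) k)) k
  | Sum.inr m => fun x => dictSign m • liftM (B.pot α (Sum.inr (dict m))) x
      - ∑ k : Fin 2, D6 N m (Sum.inl (Fin.natAdd 4 k)) x
          • liftM (scalarPot (S.val α) (T.val α) k) x

theorem liftPot_castAdd (B : Connection P) (S T : AdSection P) (α : I) (k : Fin 4) :
    liftPot B S T α (Sum.inl (Fin.castAdd 2 k)) = liftM (B.pot α (Sum.inl k)) := by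
  fin_cases k <;> rfl

theorem liftPot_natAdd (B : Connection P) (S T : AdSection P) (α : I) (k : Fin 2) :
    liftPot B S T α (Sum.inl (Fin.natAdd 4 k)) = liftM (scalarPot (S.val α) (T.val α) k) := by
  fin_cases k <;> rfl

theorem forall_coord6 {Q : Fin 6 ⊕ Odd6 → Prop} (h1 : ∀ k : Fin 4, Q (Sum.inl (Fin.castAdd 2 k)))
    (h2 : ∀ k : Fin 2, Q (Sum.inl (Fin.natAdd 4 k))) (h3 : ∀ m, Q (Sum.inr m)) : ∀ k, Q k
  | Sum.inl k => Fin.addCases (m := 4) (n := 2) (motive := fun k => Q (Sum.inl k)) h1 h2 k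
  | Sum.inr m => h3 m

theorem lieValued_liftPot (B : Connection P) (S T : AdSection P) (α : I) :
    ∀ k, IsLieValued (P.pullback.U α) (coordParity k) (liftPot B S T α k) := by
  refine forall_coord6 (fun k => ?_) (fun k => ?_) (fun m => ?_)
  · rw [liftPot_castAdd]
    exact (B.lieValued α (Sum.inl k)).lift
  · rw [liftPot_natAdd]
    exact (lieValued_scalarPot S T α k).lift
  · have h1 : IsLieValued (proj ⁻¹' P.U α) 1 (liftM (B.pot α (Sum.inr (dict m)))) :=
      (B.lieValued α (Sum.inr (dict m))).lift
    have h2 : ∀ k : Fin 2, IsLieValued (proj ⁻¹' P.U α) 1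
        (fun x => D6 N m (Sum.inl (Fin.natAdd 4 k)) x
          • liftM (scalarPot (S.val α) (T.val α) k) x) := fun k =>
      ((lieValued_scalarPot S T α k).lift).const_mul
        -- The coefficients are constant, so their parity at the origin serves at every point.
        (D6_mem_parityPart m (Sum.inl (Fin.natAdd 4 k)) 0)
    have e : liftPot B S T α (Sum.inr m) = dictSign m • liftM (B.pot α (Sum.inr (dict m)))
        + (-1 : ℂ) • ∑ k : Fin 2, (fun x => D6 N m (Sum.inl (Fin.natAdd 4 k)) x
          • liftM (scalarPot (S.val α) (T.val α) k) x) := by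
      funext x
      simp [liftPot, sub_eq_add_neg]
      abel
    rw [e]
    exact (h1.const_smul _).add ((IsLieValued.sum _ fun k _ => h2 k).const_smul _)

/-- Transition functions are constant along the vertical directions, so the scalars transform
homogeneously and leave the inhomogeneous term of `B` untouched when subtracted in the odd
components. -/
theorem liftPot_glue (B : Connection P) (S T : AdSection P) (α β : I) {x : Fin 6 → ℝ}
    (hx : proj x ∈ P.U α ∩ P.U β) : ∀ k, liftPot B S T β k x
      = liftM (P.g β α) x * liftPot B S T α k x * liftM (P.g α β) x
        + liftM (P.g β α) x * (coordField (N := N) k).actM (liftM (P.g α β)) x := by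
  have hd := P.differentiableAt_g α β hx
  have hs : ∀ k, liftM (scalarPot (S.val β) (T.val β) k) x = liftM (P.g β α) x
      * liftM (scalarPot (S.val α) (T.val α) k) x * liftM (P.g α β) x := fun k => by
    simp only [liftM]
    rw [scalarPot_glue S T α β k hx, Matrix.map_mul, Matrix.map_mul]
  have hB : ∀ k, liftM (B.pot β k) x = liftM (P.g β α) x * liftM (B.pot α k) x * liftM (P.g α β) x
      + liftM (P.g β α) x * ((coordField (N := N) k).actM (P.g α β) (proj x)).map (liftOdd N) := by
    intro k
    simp only [liftM]
    rw [B.glue α β k _ hx, Matrix.map_add _ (map_add _), Matrix.map_mul, Matrix.map_mul,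
      Matrix.map_mul]
  refine forall_coord6 (fun k => ?_) (fun k => ?_) (fun m => ?_)
  · simp only [liftPot_castAdd]
    rw [hB, ← (isLift_hLift (Sum.inl k)).actM_lift hd]
    rfl
  · simp only [liftPot_natAdd]
    have e : (coordField (N := N) (Sum.inl (Fin.natAdd 4 k) : Fin 6 ⊕ Odd6)).actM
        (liftM (P.g α β)) x = 0 := by
      rw [actM_coordField]
      ext r s
      exact pder_lift_natAdd (hd r s) k
    rw [hs, e, mul_zero, add_zero]
  · have e : (coordField (N := N) (Sum.inr m : Fin 6 ⊕ Odd6)).actM (liftM (P.g α β)) x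
        = dictSign m • ((coordField (N := N) (Sum.inr (dict m))).actM (P.g α β)
          (proj x)).map (liftOdd N) := by
      rw [actM_coordField, actM_coordField]
      ext r s
      exact pder_lift_inr (fun y => P.g α β y r s) x m
    have hg : ∀ r s, liftM (P.g β α) x r s ∈ parityPart (Odd6 ⊕ Fin N) 0 := fun r s =>
      map_mem_parityPart _ (P.even β α _ hx.symm r s)
    simp only [liftPot, hs, hB, e]
    rw [Matrix.mul_sub, Matrix.sub_mul, Finset.mul_sum, Finset.sum_mul, smul_add, Matrix.mul_smul,
      Matrix.smul_mul, Matrix.mul_smul, add_sub_right_comm]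
    congr 2
    refine Finset.sum_congr rfl fun k _ => ?_
    rw [← smul_mul_even hg, smul_mul_assoc]

/-- The connection on the pulled-back bundle with given reduction and scalars. -/
def liftConnection (B : Connection P) (S T : AdSection P) : Connection P.pullback where
  pot := liftPot B S T
  lieValued := lieValued_liftPot B S T
  glue α β k _ hx := liftPot_glue B S T α β hx k

theorem liftConnection_isTranslationInvariant (B : Connection P) (S T : AdSection P) :
    IsTranslationInvariant (liftConnection B S T) := by
  intro α k x v hv
  revert k
  refine forall_coord6 (fun k => ?_) (fun k => ?_) (fun m => ?_)
  · simp only [liftConnection, liftPot_castAdd, liftM_translate _ x v hv]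
  · simp only [liftConnection, liftPot_natAdd, liftM_translate _ x v hv]
  · simp only [liftConnection, liftPot, liftM_translate _ x v hv, D6_const m _ (x + v) x]

/-- The vertical terms subtracted in the odd components of `liftPot` cancel those contributed by the
vertical part of `D_{ai}`. -/
theorem reduces_liftConnection (B : Connection P) (S T : AdSection P) :
    Reduces (liftConnection B S T) B where
  even α k := by
    rw [← resM_liftM (B.pot α (Sum.inl k)), ← liftPot_castAdd B S T]
    rfl
  odd α m := by
    rw [← resM_liftM (B.eval α (D4s N m))]
    congr 1
    funext x
    have h1 : ∀ (c : ℂ) (M : Matrix (Fin 2) (Fin 2) (Gr (Odd4 ⊕ Fin N))),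
        (c • M).map (liftOdd N) = c • M.map (liftOdd N) := fun c M => by ext r s; simp
    simp only [liftM]
    rw [Connection.eval_D6, Connection.eval_D4s, Matrix.map_add _ (map_add _), map_liftOdd_sum, h1]
    simp only [liftConnection, liftPot_castAdd, liftPot_natAdd, map_liftOdd_smul,
      ← (isLift_D6 m).even]
    simp only [liftPot, liftM]
    abel

theorem hasScalars_liftConnection (B : Connection P) (S T : AdSection P) :
    HasScalars (liftConnection B S T) S T := fun α k => by
  rw [← resM_liftM (scalarPot (S.val α) (T.val α) k), ← liftPot_natAdd B S T]
  rfl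

end

end SuperConn

end

/-! ### The bijection -/

theorem mainTheorem3 (N : ℕ) {I : Type*}
    (P : SuperConn.Bundle 4 SuperConn.Odd4 N I) :
    ∃ e : {A : SuperConn.Connection P.pullback //
            SuperConn.IsConstrained A ∧ SuperConn.IsTranslationInvariant A} ≃
          {B : SuperConn.Connection P // SuperConn.IsSemiConstrained B},
      ∀ A, SuperConn.IsReduction A.1 (e A).1 ∧
        ∃ S Sbar : SuperConn.AdSection P,
          SuperConn.IsSemiConstrainedWith (e A).1 S Sbar ∧
          (∀ α, S.val α = (2 : ℂ) • SuperConn.resM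
            (A.1.eval α (SuperConn.constField (SuperConn.dy6 2 3)))) ∧
          (∀ α, Sbar.val α = (2 : ℂ) • SuperConn.resM
            (A.1.eval α (SuperConn.constField (SuperConn.dy6 0 1)))) := by
  have hsemi : ∀ A : {A : SuperConn.Connection P.pullback //
      SuperConn.IsConstrained A ∧ SuperConn.IsTranslationInvariant A}, ∀ S T,
      SuperConn.HasScalars A.1 S T →
        SuperConn.IsSemiConstrainedWith (SuperConn.reduction A.1) S T := fun A S T h =>
    (SuperConn.isConstrained_iff_isSemiConstrainedWith A.2.2
      (SuperConn.reduces_reduction A.1) h).1 A.2.1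
  let F : {A : SuperConn.Connection P.pullback //
      SuperConn.IsConstrained A ∧ SuperConn.IsTranslationInvariant A} →
      {B : SuperConn.Connection P // SuperConn.IsSemiConstrained B} := fun A =>
    ⟨SuperConn.reduction A.1, by
      obtain ⟨S, T, h⟩ := SuperConn.exists_hasScalars A.1
      exact ⟨S, T, hsemi A S T h⟩⟩
  have hF : Function.Bijective F := by
    constructor
    · intro A A' e
      have e' : SuperConn.reduction A.1 = SuperConn.reduction A'.1 := congrArg Subtype.val e
      obtain ⟨S, T, h⟩ := SuperConn.exists_hasScalars A.1
      obtain ⟨S', T', h'⟩ := SuperConn.exists_hasScalars A'.1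
      have h1 := hsemi A S T h
      rw [e'] at h1
      -- Both pairs of scalars occur in the curvature of the same reduced connection, so they
      -- coincide.
      obtain ⟨rfl, rfl⟩ := h1.unique (hsemi A' S' T' h')
      have h2 := SuperConn.reduces_reduction A.1
      rw [e'] at h2
      exact Subtype.ext (SuperConn.connection_eq_of_reduces A.2.2 A'.2.2 h2
        (SuperConn.reduces_reduction A'.1) h h')
    · rintro ⟨B, S, T, hB⟩
      have hr := SuperConn.reduces_liftConnection B S T
      have ht := SuperConn.liftConnection_isTranslationInvariant B S T
      -- The preimage is built with the scalars of `B` themselves as vertical components, which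
      -- makes it constrained.
      exact ⟨⟨SuperConn.liftConnection B S T,
        (SuperConn.isConstrained_iff_isSemiConstrainedWith ht hr
          (SuperConn.hasScalars_liftConnection B S T)).2 hB, ht⟩,
        Subtype.ext ((SuperConn.reduces_reduction _).unique hr)⟩
  refine ⟨Equiv.ofBijective F hF, fun A => ⟨(SuperConn.reduces_reduction A.1).isReduction, ?_⟩⟩
  obtain ⟨S, T, h⟩ := SuperConn.exists_hasScalars A.1
  obtain ⟨hS, hT⟩ := SuperConn.hasScalars_iff.1 h
  exact ⟨S, T, hsemi A S T h, hS, hT⟩
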